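/- Let $n\ge 0$. For an associative unital $\mathbb C$-algebra $A$ put $L_1(A)=A$, $L_{i+1}(A)=[A,L_i(A)]$ (linear span of commutators), and let $M_i(A)=A\,L_i(A)\,A$ be the two-sided ideal generated by $L_i(A)$. For $i\ge1$ let $B_i=L_i/L_{i+1}$ and $N_i=M_i/M_{i+1}$, let $Z\subset B_1$ be the image of $M_3$, and let $\bar B_1=B_1/Z$. Every derivation $D\in\mathrm{Der}(A)$ preserves all $L_i$ and $M_i$, so the Lie algebra $\mathrm{Der}(A)$ acts on $\bar B_1$, $B_i$ and $N_i$; it also maps to $\mathrm{Der}(A/M_3)$ by a natural map $\psi$. Let $A_n=\mathbb C\langle x_1,\dots,x_n\rangle$ be the free algebra, with $A_n[d]$ the span of the words of length $d$, and let $\bar B_1[d]$, $B_i[d]$, $N_i[d]$ be the images of $A_n[d]$, $L_i\cap A_n[d]$, $M_i\cap A_n[d]$ in $\bar B_1(A_n)$, $B_i(A_n)$, $N_i(A_n)$. Let $W_n$ be the Lie algebra of polynomial vector fields $\sum_i f_i\partial_i$, $f_i\in\mathbb C[x_1,\dots,x_n]$, and let $W_n[k]$ consist of those with all $f_i$ homogeneous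 of degree $k+1$. Let $\Omega^{\rm even}_*$ be the space of even differential forms on $\mathbb C^n$ with polynomial coefficients, with the associative product $\alpha*\beta=\alpha\wedge\beta+\tfrac12\,d\alpha\wedge d\beta$. Then: (a) For every associative unital $\mathbb C$-algebra $A$, each $D\in \mathrm{Der}(A)$ with $D(A)\subset M_3(A)$ acts by zero on $\bar B_1(A)$, on $B_i(A)$ for $i\ge2$, and on $N_i(A)$ for $i\ge 1$. (b) The map $\psi:\mathrm{Der}(A_n)\to\mathrm{Der}(A_n/M_3)$ is surjective. (c) $W_n=\bigoplus_{k\in\mathbb Z}W_n[k]$ is a graded Lie algebra. There is an algebra isomorphism $\varphi:A_n/M_3\to\Omega^{\rm even}_*$ with $\varphi(x_i)=x_i$, and the Lie derivative $v\mapsto \mathcal L_v$ is an injective homomorphism of Lie algebras $W_n\to\mathrm{Der}(\Omega^{\rm even}_*)$. (d) Let $V$ be any of the spaces $\bar B_1(A_n)$, $B_i(A_n)$ with $i\ge2$, or $N_i(A_n)$ with $i\ge1$. There is a unique representation of $W_n$ on $V$ in which each $v\in W_n$ acts as every derivation $D\in \mathrm{Der}(A_n)$ such that $\varphi\circ\psi(D)=\mathcal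 L_v\circ\varphi$. With it, $V$ is a graded $W_n$-module: $V=\bigoplus_{d\ge0}V[d]$ and $W_n[k]\,V[d]\subset V[d+k]$, where $V[e]=0$ for $e<0$. -/

import Mathlib

open scoped TensorProduct

attribute [local instance 100] LieRing.ofAssociativeRing

noncomputable section

namespace LCS

/-! ### The lower central series of an associative algebra -/

section General

variable (A : Type*) [Ring A] [Algebra ℂ A]

/-- `L_i(A)` for `i ≥ 1`: the lower central series of `A` viewed as a Lie algebra under the
commutator, `L_1 = A` and `L_{i+1} = [A, L_i]`. (Mathlib's numbering starts with `0`.) -/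
def L (i : ℕ) : Submodule ℂ A :=
  (LieModule.lowerCentralSeries ℂ A A (i - 1)).toSubmodule

/-- `M_i(A) = A L_i A`: the two-sided ideal generated by `L_i(A)`. -/
def M (i : ℕ) : Ideal A :=
  (TwoSidedIdeal.span (L A i : Set A)).asIdeal

instance (i : ℕ) : (M A i).IsTwoSided :=
  inferInstanceAs ((TwoSidedIdeal.span (L A i : Set A)).asIdeal).IsTwoSided

/-- `M_i(A)` as a linear subspace of `A`. -/
abbrev Mc (i : ℕ) : Submodule ℂ A := (M A i).restrictScalars ℂ

/-- `B_i = L_i / L_{i+1}`. -/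
abbrev B (i : ℕ) : Type _ := L A i ⧸ (L A (i + 1)).submoduleOf (L A i)

/-- `N_i = M_i / M_{i+1}`. -/
abbrev N (i : ℕ) : Type _ := Mc A i ⧸ (Mc A (i + 1)).submoduleOf (Mc A i)

/-- `Z`, the image of `M_3` in `B_1 = L_1 / L_2` (recall that `L_1 = A`). -/
def Z : Submodule ℂ (B A 1) :=
  ((Mc A 3).submoduleOf (L A 1)).map ((L A 2).submoduleOf (L A 1)).mkQ

/-- `B̄_1 = B_1 / Z`. -/
abbrev Bbar1 : Type _ := B A 1 ⧸ Z A

/-- The Lie algebra of (`ℂ`-linear) derivations of the associative algebra `A`. -/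
def Der : LieSubalgebra ℂ (Module.End ℂ A) where
  carrier := {D | ∀ a b, D (a * b) = D a * b + a * D b}
  add_mem' := by
    intro D E hD hE a b
    simp only [LinearMap.add_apply, hD a b, hE a b, add_mul, mul_add]
    abel
  zero_mem' := by
    intro a b
    simp
  smul_mem' := by
    intro c D hD a b
    simp only [LinearMap.smul_apply, hD a b, smul_add, smul_mul_assoc, mul_smul_comm]
  lie_mem' := by
    intro D E hD hE a b
    simp only [Set.mem_ofPred_eq] at hD hE
    simp only [Ring.lie_def, LinearMap.sub_apply, Module.End.mul_apply, hD, hE, map_add,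
      sub_mul, mul_sub]
    abel

variable {A}

theorem Der.leibniz (D : Der A) (a b : A) : D.1 (a * b) = D.1 a * b + a * D.1 b := D.2 a b

theorem Der.map_lie (D : Der A) (a b : A) : D.1 ⁅a, b⁆ = ⁅D.1 a, b⁆ + ⁅a, D.1 b⁆ := by
  simp only [Ring.lie_def, map_sub, Der.leibniz]
  abel

theorem Der.map_L (D : Der A) (i : ℕ) : ∀ x ∈ L A i, D.1 x ∈ L A i := by
  unfold L
  induction (i - 1) with
  | zero => intro x _; simp
  | succ k ih =>
    intro x hx
    rw [LieModule.lowerCentralSeries_succ] at hx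
    rw [LieSubmodule.lieIdeal_oper_eq_linear_span'] at hx
    induction hx using Submodule.span_induction with
    | mem x hx =>
      obtain ⟨a, ha, l, hl, rfl⟩ := hx
      rw [Der.map_lie]
      change _ ∈ LieModule.lowerCentralSeries ℂ A A (k + 1)
      rw [LieModule.lowerCentralSeries_succ]
      exact add_mem
        (LieSubmodule.lie_mem_lie (LieSubmodule.mem_top _) hl)
        (LieSubmodule.lie_mem_lie ha (ih l hl))
    | zero => rw [map_zero]; exact Submodule.zero_mem _
    | add x y _ _ hx hy => rw [map_add]; exact Submodule.add_mem _ hx hy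
    | smul c x _ hx => rw [map_smul]; exact Submodule.smul_mem _ c hx

theorem Der.map_M (D : Der A) (i : ℕ) : ∀ x ∈ Mc A i, D.1 x ∈ Mc A i := by
  intro x hx
  change x ∈ TwoSidedIdeal.asIdeal _ at hx
  change D.1 x ∈ TwoSidedIdeal.asIdeal _
  rw [TwoSidedIdeal.mem_asIdeal] at hx ⊢
  have key : ∀ y ∈ L A i, y ∈ TwoSidedIdeal.span (L A i : Set A) :=
    fun y hy => TwoSidedIdeal.subset_span hy
  induction hx using TwoSidedIdeal.span_induction with
  | mem x hx => exact key _ (Der.map_L D i x hx)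
  | zero => rw [map_zero]; exact TwoSidedIdeal.zero_mem _
  | add x y _ _ hx hy => rw [map_add]; exact TwoSidedIdeal.add_mem _ hx hy
  | neg x _ hx => rw [map_neg]; exact TwoSidedIdeal.neg_mem _ hx
  | left_absorb a x hx' hx =>
    rw [Der.leibniz]
    exact TwoSidedIdeal.add_mem _ (TwoSidedIdeal.mul_mem_left _ _ _ hx')
      (TwoSidedIdeal.mul_mem_left _ _ _ hx)
  | right_absorb b x hx' hx =>
    rw [Der.leibniz]
    exact TwoSidedIdeal.add_mem _ (TwoSidedIdeal.mul_mem_right _ _ _ hx)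
      (TwoSidedIdeal.mul_mem_right _ _ _ hx')

/-- Restriction of a representation to an invariant subspace. -/
def subRep {𝔤 V : Type*} [LieRing 𝔤] [LieAlgebra ℂ 𝔤] [AddCommGroup V] [Module ℂ V]
    (ρ : 𝔤 →ₗ⁅ℂ⁆ Module.End ℂ V) (P : Submodule ℂ V) (hP : ∀ g, ∀ x ∈ P, ρ g x ∈ P) :
    𝔤 →ₗ⁅ℂ⁆ Module.End ℂ P where
  toFun g := (ρ g).restrict (hP g)
  map_add' g h := by ext x; simp
  map_smul' c g := by ext x; simp
  map_lie' {g h} := by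
    ext x
    simp [Ring.lie_def]

/-- The representation on the quotient by an invariant subspace. -/
def quotRep {𝔤 V : Type*} [LieRing 𝔤] [LieAlgebra ℂ 𝔤] [AddCommGroup V] [Module ℂ V]
    (ρ : 𝔤 →ₗ⁅ℂ⁆ Module.End ℂ V) (Q : Submodule ℂ V) (hQ : ∀ g, ∀ x ∈ Q, ρ g x ∈ Q) :
    𝔤 →ₗ⁅ℂ⁆ Module.End ℂ (V ⧸ Q) where
  toFun g := Q.mapQ Q (ρ g) (hQ g)
  map_add' g h := by ext x; simp
  map_smul' c g := by ext x; simp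
  map_lie' {g h} := by
    ext x
    simp [Ring.lie_def]

variable (A)

/-- The natural action of `Der(A)` on `L_i(A)`. -/
def actL (i : ℕ) : Der A →ₗ⁅ℂ⁆ Module.End ℂ (L A i) :=
  subRep (Der A).incl (L A i) (fun D => Der.map_L D i)

/-- The natural action of `Der(A)` on `M_i(A)`. -/
def actM (i : ℕ) : Der A →ₗ⁅ℂ⁆ Module.End ℂ (Mc A i) :=
  subRep (Der A).incl (Mc A i) (fun D => Der.map_M D i)

/-- The natural action of `Der(A)` on `B_i(A)`: the class of `a ∈ L_i` is sent to that of `D a`. -/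
def actB (i : ℕ) : Der A →ₗ⁅ℂ⁆ Module.End ℂ (B A i) :=
  quotRep (actL A i) _ (fun D x hx => Der.map_L D (i + 1) x.1 hx)

/-- The natural action of `Der(A)` on `N_i(A)`. -/
def actN (i : ℕ) : Der A →ₗ⁅ℂ⁆ Module.End ℂ (N A i) :=
  quotRep (actM A i) _ (fun D x hx => Der.map_M D (i + 1) x.1 hx)

/-- The natural action of `Der(A)` on `B̄_1(A)`. -/
def actBbar1 : Der A →ₗ⁅ℂ⁆ Module.End ℂ (Bbar1 A) :=
  quotRep (actB A 1) (Z A) (by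
    rintro D _ ⟨x, hx, rfl⟩
    exact ⟨actL A 1 D x, Der.map_M D 3 x.1 hx, rfl⟩)

/-- The natural map `ψ : Der(A) → Der(A / M_3)`. -/
def psi : Der A →ₗ⁅ℂ⁆ Der (A ⧸ M A 3) where
  toFun D := ⟨quotRep (Der A).incl (Mc A 3) (fun D => Der.map_M D 3) D, by
    intro a b
    obtain ⟨a, rfl⟩ := Ideal.Quotient.mk_surjective a
    obtain ⟨b, rfl⟩ := Ideal.Quotient.mk_surjective b
    change Ideal.Quotient.mk (M A 3) (D.1 (a * b)) =
      Ideal.Quotient.mk (M A 3) (D.1 a) * Ideal.Quotient.mk (M A 3) b +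
        Ideal.Quotient.mk (M A 3) a * Ideal.Quotient.mk (M A 3) (D.1 b)
    rw [Der.leibniz, map_add, map_mul, map_mul]⟩
  map_add' D E := Subtype.ext
    (map_add (quotRep (Der A).incl (Mc A 3) (fun D => Der.map_M D 3)) D E)
  map_smul' c D := Subtype.ext
    (map_smul (quotRep (Der A).incl (Mc A 3) (fun D => Der.map_M D 3)) c D)
  map_lie' {D E} := Subtype.ext
    (LieHom.map_lie (quotRep (Der A).incl (Mc A 3) (fun D => Der.map_M D 3)) D E)

end General

/-! ### Polynomial differential forms on `ℂⁿ` -/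

section Forms

variable (n : ℕ)

/-- `ℂ[x_1, …, x_n]`. -/
abbrev Poly : Type := MvPolynomial (Fin n) ℂ

/-- The exterior algebra on the symbols `dx_1, …, dx_n`. -/
abbrev Ext : Type := ExteriorAlgebra ℂ (Fin n → ℂ)

/-- The symbol `dx_i`. -/
def dx (i : Fin n) : Ext n := ExteriorAlgebra.ι ℂ (Pi.single i 1)

/-- The algebra `Ω` of polynomial differential forms on `ℂⁿ` under the wedge product: it is free
over `ℂ[x_1, …, x_n]` with basis `dx_{i_1} ∧ ⋯ ∧ dx_{i_k}`, `i_1 < ⋯ < i_k`. -/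
abbrev Forms : Type := Poly n ⊗[ℂ] Ext n

/-- The de Rham differential, `d (f ω) = ∑ i, (∂f/∂x_i) dx_i ∧ ω` for `ω` a product of `dx_j`. -/
def deRham : Forms n →ₗ[ℂ] Forms n :=
  ∑ i, TensorProduct.map (MvPolynomial.pderiv i).toLinearMap (LinearMap.mulLeft ℂ (dx n i))

/-- The algebra `Ω^even` of even forms (under the wedge product). -/
def evenForms : Subalgebra ℂ (Forms n) :=
  (Algebra.TensorProduct.map (AlgHom.id ℂ (Poly n))
    (CliffordAlgebra.even (0 : QuadraticForm ℂ (Fin n → ℂ))).val).range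

variable {n}

theorem dx_comm_even (i : Fin n) (w : Ext n)
    (hw : w ∈ CliffordAlgebra.even (0 : QuadraticForm ℂ (Fin n → ℂ))) :
    dx n i * w = w * dx n i := by
  have anti : ∀ a b : Fin n → ℂ, ExteriorAlgebra.ι ℂ a * ExteriorAlgebra.ι ℂ b =
      -(ExteriorAlgebra.ι ℂ b * ExteriorAlgebra.ι ℂ a) := fun a b =>
    eq_neg_of_add_eq_zero_left (ExteriorAlgebra.ι_add_mul_swap a b)
  refine CliffordAlgebra.even_induction (0 : QuadraticForm ℂ (Fin n → ℂ))
    (motive := fun w _ => dx n i * w = w * dx n i) ?_ ?_ ?_ w hw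
  · intro r; exact (Algebra.commutes r _).symm
  · intro x y _ _ hx hy; rw [mul_add, add_mul, hx, hy]
  · intro a b x _ hx
    change ExteriorAlgebra.ι ℂ _ * (ExteriorAlgebra.ι ℂ a * ExteriorAlgebra.ι ℂ b * x) =
      ExteriorAlgebra.ι ℂ a * ExteriorAlgebra.ι ℂ b * x * ExteriorAlgebra.ι ℂ _
    change ExteriorAlgebra.ι ℂ _ * x = x * ExteriorAlgebra.ι ℂ _ at hx
    rw [mul_assoc _ x, ← hx, ← mul_assoc, ← mul_assoc, anti _ a, neg_mul, mul_assoc _ _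
      (ExteriorAlgebra.ι ℂ b), anti _ b]
    simp only [mul_assoc, mul_neg, neg_neg]

theorem even_induction {p : Forms n → Prop} (tmul : ∀ (f : Poly n) (w : Ext n),
    w ∈ CliffordAlgebra.even (0 : QuadraticForm ℂ (Fin n → ℂ)) → p (f ⊗ₜ w))
    (add : ∀ a b, p a → p b → p (a + b)) (a : Forms n) (ha : a ∈ evenForms n) : p a := by
  obtain ⟨t, rfl⟩ := ha
  induction t using TensorProduct.induction_on with
  | zero => simpa using tmul 0 0 (Subalgebra.zero_mem _)
  | tmul f w => exact tmul f w.1 w.2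
  | add x y hx hy => rw [map_add]; exact add _ _ hx hy

theorem tmul_mem_even (f : Poly n) (w : Ext n)
    (hw : w ∈ CliffordAlgebra.even (0 : QuadraticForm ℂ (Fin n → ℂ))) :
    (f ⊗ₜ w : Forms n) ∈ evenForms n :=
  ⟨f ⊗ₜ ⟨w, hw⟩, rfl⟩

theorem deRham_tmul (f : Poly n) (w : Ext n) :
    deRham n (f ⊗ₜ w) = ∑ i, MvPolynomial.pderiv i f ⊗ₜ (dx n i * w) := by
  simp [deRham, LinearMap.sum_apply]

theorem deRham_mul {a : Forms n} (ha : a ∈ evenForms n) (b : Forms n) :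
    deRham n (a * b) = deRham n a * b + a * deRham n b := by
  refine even_induction (p := fun a => deRham n (a * b) = deRham n a * b + a * deRham n b)
    ?_ ?_ a ha
  · intro f w hw
    induction b using TensorProduct.induction_on with
    | zero => simp
    | tmul g u =>
      simp only [Algebra.TensorProduct.tmul_mul_tmul, deRham_tmul, Finset.sum_mul,
        Finset.mul_sum, ← Finset.sum_add_distrib]
      refine Finset.sum_congr rfl fun i _ => ?_
      rw [Derivation.leibniz, smul_eq_mul, smul_eq_mul, ← mul_assoc w, ← dx_comm_even i w hw,
        TensorProduct.add_tmul, mul_assoc, mul_comm g, add_comm]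
    | add x y hx hy => simp only [mul_add, map_add, hx, hy]; abel
  · intro x y hx hy
    simp only [add_mul, map_add, hx, hy]; abel

theorem pderiv_comm (i j : Fin n) (f : Poly n) :
    MvPolynomial.pderiv i (MvPolynomial.pderiv j f) =
      MvPolynomial.pderiv j (MvPolynomial.pderiv i f) := by
  have h : ⁅(MvPolynomial.pderiv i : Derivation ℂ (Poly n) (Poly n)), MvPolynomial.pderiv j⁆ = 0 :=
    MvPolynomial.derivation_ext fun k => by
      classical
      rw [Derivation.commutator_apply]
      simp [ MvPolynomial.pderiv_X, Pi.single_apply, apply_ite]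
  have := congrArg (fun D : Derivation ℂ (Poly n) (Poly n) => D f) h
  rwa [Derivation.commutator_apply, Derivation.zero_apply, sub_eq_zero] at this

theorem dx_anti (i j : Fin n) : dx n i * dx n j = -(dx n j * dx n i) :=
  eq_neg_of_add_eq_zero_left (ExteriorAlgebra.ι_add_mul_swap _ _)

theorem deRham_deRham (a : Forms n) : deRham n (deRham n a) = 0 := by
  induction a using TensorProduct.induction_on with
  | zero => simp
  | tmul f w =>
    simp only [deRham_tmul, map_sum]
    have h : ∀ S : Forms n, S = -S → S = 0 := fun S hS => by
      have h2 : (2 : ℂ) • S = 0 := by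
        rw [two_smul]; nth_rewrite 1 [hS]; exact neg_add_cancel S
      rw [← inv_smul_smul₀ (two_ne_zero (α := ℂ)) S, h2, smul_zero]
    apply h
    conv_rhs => rw [Finset.sum_comm]
    rw [← Finset.sum_neg_distrib]
    refine Finset.sum_congr rfl fun i _ => ?_
    rw [← Finset.sum_neg_distrib]
    refine Finset.sum_congr rfl fun j _ => ?_
    rw [← mul_assoc, ← mul_assoc, dx_anti i j, neg_mul, TensorProduct.tmul_neg, neg_neg,
      pderiv_comm]
  | add x y hx hy => rw [map_add, map_add, hx, hy, add_zero]

theorem deRham_mul_deRham_mem {a b : Forms n} (ha : a ∈ evenForms n) (hb : b ∈ evenForms n) :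
    deRham n a * deRham n b ∈ evenForms n := by
  refine even_induction (p := fun a => deRham n a * deRham n b ∈ evenForms n) ?_ ?_ a ha
  · intro f w hw
    refine even_induction (p := fun b => deRham n (f ⊗ₜ w) * deRham n b ∈ evenForms n) ?_ ?_ b hb
    · intro g u hu
      simp only [deRham_tmul, Finset.sum_mul, Finset.mul_sum,
        Algebra.TensorProduct.tmul_mul_tmul]
      refine Subalgebra.sum_mem _ fun i _ => Subalgebra.sum_mem _ fun j _ => ?_
      refine tmul_mem_even _ _ ?_
      rw [dx_comm_even _ w hw, dx_comm_even _ u hu]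
      have h2 : dx n j * dx n i ∈ CliffordAlgebra.even (0 : QuadraticForm ℂ (Fin n → ℂ)) :=
        CliffordAlgebra.ι_mul_ι_mem_evenOdd_zero _ _ _
      have : w * dx n j * (u * dx n i) = w * u * (dx n j * dx n i) := by
        rw [mul_assoc w, ← mul_assoc _ u, dx_comm_even _ u hu]; simp only [mul_assoc]
      rw [this]
      exact Subalgebra.mul_mem _ (Subalgebra.mul_mem _ hw hu) h2
    · intro x y hx hy; rw [map_add, mul_add]; exact Subalgebra.add_mem _ hx hy
  · intro x y hx hy; rw [map_add, add_mul]; exact Subalgebra.add_mem _ hx hy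

/-- On the wedge products of differentials, `d` acts by the graded Leibniz rule. -/
theorem deRham_deRham_mul {a b : Forms n} (ha : a ∈ evenForms n) :
    deRham n (deRham n a * b) = -(deRham n a * deRham n b) := by
  have h := congrArg (deRham n) (deRham_mul ha b)
  rw [deRham_deRham, map_add, deRham_mul ha, deRham_deRham, mul_zero, add_zero] at h
  exact eq_neg_of_add_eq_zero_left h.symm

variable (n)

/-- `Ω_*^even`: the space of even polynomial forms on `ℂⁿ`, to be equipped with the product
`α * β = α ∧ β + ½ dα ∧ dβ`. -/
def OmegaStar : Type := evenForms n

variable {n}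

/-- The underlying differential form of an element of `Ω_*^even`. -/
def OmegaStar.form (a : OmegaStar n) : Forms n := Subtype.val (p := (· ∈ evenForms n)) a

theorem OmegaStar.form_mem (a : OmegaStar n) : a.form ∈ evenForms n :=
  Subtype.property (p := (· ∈ evenForms n)) a

@[ext]
theorem OmegaStar.ext {a b : OmegaStar n} (h : a.form = b.form) : a = b := Subtype.ext h

instance : AddCommGroup (OmegaStar n) := inferInstanceAs (AddCommGroup (evenForms n))

instance : Module ℂ (OmegaStar n) := inferInstanceAs (Module ℂ (evenForms n))

/-- The product `α * β = α ∧ β + ½ dα ∧ dβ`. -/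
instance : Mul (OmegaStar n) where
  mul a b := ⟨a.form * b.form + (1 / 2 : ℂ) • (deRham n a.form * deRham n b.form),
    Subalgebra.add_mem _ (Subalgebra.mul_mem _ a.form_mem b.form_mem)
      (Subalgebra.smul_mem _ (deRham_mul_deRham_mem a.form_mem b.form_mem) _)⟩

instance : One (OmegaStar n) where
  one := ⟨1, Subalgebra.one_mem _⟩

@[simp] theorem OmegaStar.form_zero : (0 : OmegaStar n).form = 0 := rfl

@[simp] theorem OmegaStar.form_one : (1 : OmegaStar n).form = 1 := rfl

@[simp] theorem OmegaStar.form_add (a b : OmegaStar n) : (a + b).form = a.form + b.form := rfl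

@[simp] theorem OmegaStar.form_smul (c : ℂ) (a : OmegaStar n) : (c • a).form = c • a.form := rfl

theorem OmegaStar.form_mul (a b : OmegaStar n) : (a * b).form =
    a.form * b.form + (1 / 2 : ℂ) • (deRham n a.form * deRham n b.form) := rfl

theorem deRham_one : deRham n (1 : Forms n) = 0 := by
  rw [Algebra.TensorProduct.one_def, deRham_tmul]
  simp

instance : Ring (OmegaStar n) :=
  { (inferInstance : AddCommGroup (OmegaStar n)), (inferInstance : Mul (OmegaStar n)),
    (inferInstance : One (OmegaStar n)) with
    left_distrib := fun a b c => by
      ext; simp only [OmegaStar.form_mul, OmegaStar.form_add, map_add, mul_add, smul_add]; abel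
    right_distrib := fun a b c => by
      ext; simp only [OmegaStar.form_mul, OmegaStar.form_add, map_add, add_mul, smul_add]; abel
    zero_mul := fun a => by ext; simp [OmegaStar.form_mul]
    mul_zero := fun a => by ext; simp [OmegaStar.form_mul]
    one_mul := fun a => by ext; simp [OmegaStar.form_mul, deRham_one]
    mul_one := fun a => by ext; simp [OmegaStar.form_mul, deRham_one]
    mul_assoc := fun a b c => by
      ext
      have ha := a.form_mem
      have hb := b.form_mem
      simp only [OmegaStar.form_mul, map_add, map_smul, deRham_mul ha, deRham_mul hb,
        deRham_deRham_mul ha, deRham_deRham_mul hb, deRham_deRham, mul_zero, zero_mul, add_mul,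
        mul_add, smul_add, smul_mul_assoc, mul_smul_comm, mul_assoc, smul_zero, neg_zero]
      abel }

instance : Algebra ℂ (OmegaStar n) :=
  Algebra.ofModule
    (fun c a b => by
      ext
      simp only [OmegaStar.form_mul, OmegaStar.form_smul, map_smul, smul_mul_assoc, smul_add,
        smul_comm c])
    (fun c a b => by
      ext
      simp only [OmegaStar.form_mul, OmegaStar.form_smul, map_smul, mul_smul_comm, smul_add,
        smul_comm c])

/-- The function `x_i` as an element of `Ω_*^even`. -/
def OmegaStar.x (i : Fin n) : OmegaStar n :=
  ⟨MvPolynomial.X i ⊗ₜ 1, tmul_mem_even _ _ (Subalgebra.one_mem _)⟩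

variable (n)

/-- `W_n`: the Lie algebra of polynomial vector fields `∑ i, f_i ∂_i` on `ℂⁿ`, that is, of
derivations of `ℂ[x_1, …, x_n]` under the commutator; the coefficient `f_i` of `v` is `v x_i`. -/
abbrev W : Type := Derivation ℂ (Poly n) (Poly n)

variable {n}

/-- The interior product `ι_v = ∑ i, f_i ι_{∂_i}` with the vector field `v = ∑ i, f_i ∂_i`. -/
def interiorProduct (v : W n) : Forms n →ₗ[ℂ] Forms n :=
  ∑ i, TensorProduct.map (LinearMap.mulLeft ℂ (v (MvPolynomial.X i)))
    (CliffordAlgebra.contractLeft (Q := (0 : QuadraticForm ℂ (Fin n → ℂ))) (LinearMap.proj i))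

/-- The Lie derivative of differential forms along `v`, `d ι_v + ι_v d`. -/
def lieDerivative (v : W n) : Forms n →ₗ[ℂ] Forms n :=
  deRham n ∘ₗ interiorProduct v + interiorProduct v ∘ₗ deRham n

end Forms

/-! ### Gradings -/

section Gradings

variable (n : ℕ)

/-- The free algebra `A_n = ℂ⟨x_1, …, x_n⟩`. -/
abbrev An : Type := FreeAlgebra ℂ (Fin n)

/-- `A_n[d]`: the span of the words of length `d` in `x_1, …, x_n`. -/
def grA (d : ℕ) : Submodule ℂ (An n) :=
  Submodule.span ℂ (Set.range (FreeAlgebra.ι ℂ : Fin n → An n)) ^ d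

/-- `B_i[d]`: the image of `L_i ∩ A_n[d]` in `B_i(A_n)`. -/
def grB (i d : ℕ) : Submodule ℂ (B (An n) i) :=
  ((grA n d).submoduleOf (L (An n) i)).map (Submodule.mkQ _)

/-- `N_i[d]`: the image of `M_i ∩ A_n[d]` in `N_i(A_n)`. -/
def grN (i d : ℕ) : Submodule ℂ (N (An n) i) :=
  ((grA n d).submoduleOf (Mc (An n) i)).map (Submodule.mkQ _)

/-- `B̄_1[d]`: the image of `A_n[d]` in `B̄_1(A_n)`. -/
def grBbar1 (d : ℕ) : Submodule ℂ (Bbar1 (An n)) :=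
  (grB n 1 d).map (Z (An n)).mkQ

/-- `W_n[k]`: the vector fields `∑ i, f_i ∂_i` with all `f_i` homogeneous of degree `k + 1`
(so that `W_n[k] = 0` for `k < -1`). -/
def grW (k : ℤ) : Submodule ℂ (W n) where
  carrier := {v | ∀ i, ∀ m ∈ (v (MvPolynomial.X i)).support, (m.degree : ℤ) = k + 1}
  add_mem' := by
    intro v w hv hw i m hm
    rw [Derivation.add_apply] at hm
    rcases Finset.mem_union.mp (MvPolynomial.support_add hm) with h | h
    · exact hv i m h
    · exact hw i m h
  zero_mem' := by
    intro i m hm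
    simp at hm
  smul_mem' := by
    intro c v hv i m hm
    rw [Derivation.smul_apply] at hm
    exact hv i m (MvPolynomial.support_smul hm)

variable {n}

/-- The derivation `D` of `A_n` induces on `A_n / M_3 ≅ Ω_*^even` the derivation `lam v`. -/
def IsLift (φ : (An n ⧸ M (An n) 3) ≃ₐ[ℂ] OmegaStar n) (lam : W n →ₗ⁅ℂ⁆ Der (OmegaStar n))
    (v : W n) (D : Der (An n)) : Prop :=
  ∀ q : An n ⧸ M (An n) 3,
    φ ((psi (An n) D : Module.End ℂ (An n ⧸ M (An n) 3)) q) =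
      (lam v : Module.End ℂ (OmegaStar n)) (φ q)

/-- The representation `ρ` of `W_n` on `V` is induced by the representation `act` of `Der(A_n)`:
`v` acts as any derivation of `A_n` which induces `lam v` on `A_n / M_3 ≅ Ω_*^even`. -/
def IsInduced (φ : (An n ⧸ M (An n) 3) ≃ₐ[ℂ] OmegaStar n) (lam : W n →ₗ⁅ℂ⁆ Der (OmegaStar n))
    {V : Type*} [AddCommGroup V] [Module ℂ V] (act : Der (An n) →ₗ⁅ℂ⁆ Module.End ℂ V)
    (ρ : W n →ₗ⁅ℂ⁆ Module.End ℂ V) : Prop :=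
  ∀ (v : W n) (D : Der (An n)), IsLift φ lam v D → ρ v = act D

/-- The representation `ρ` of `W_n` on `V`, with the family `V[d]`, `d ≥ 0`, of subspaces of `V`,
is a graded `W_n`-module: `V` is the direct sum of the `V[d]` and `W_n[k] V[d] ⊆ V[d + k]`, where
`V[e] = 0` for `e < 0`. -/
structure IsGradedModule {V : Type*} [AddCommGroup V] [Module ℂ V]
    (ρ : W n →ₗ⁅ℂ⁆ Module.End ℂ V) (gr : ℕ → Submodule ℂ V) : Prop where
  isInternal : DirectSum.IsInternal gr
  map_mem : ∀ (k : ℤ) (d e : ℕ), (e : ℤ) = d + k → ∀ v ∈ grW n k, ∀ x ∈ gr d, ρ v x ∈ gr e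
  map_eq_zero : ∀ (k : ℤ) (d : ℕ), (d : ℤ) + k < 0 → ∀ v ∈ grW n k, ∀ x ∈ gr d, ρ v x = 0

end Gradings

end LCS

end

/-!
The action of `W_n` exists for three reasons.

*Derivations with image in `M_3` act by zero.* The cyclic identity `[xy, z] + [yz, x] + [zx, y] = 0`
gives `[L_2 L_2, A] ⊆ L_3` (`lie_L_two_mul_L_two`), and `a[b, m] = [b, am] - [b, a]m` reduces
`[M_3, A] ⊆ L_3` to it; the Jacobi identity then yields `[M_3, L_k] ⊆ L_{k+2}` (`lie_M_three_L`).
Latyshev's inclusions `M_i M_3, M_3 M_i ⊆ M_{i+1}` (`M_mul_M_three`, `M_three_mul_M`) follow from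
the fact that, modulo `M_{i+1}`, elements of `L_i` are central and `L_i L_2` is contained in `L_i`.
Hence a derivation with image in `M_3` maps `L_i` to `L_{i+1}` for `i ≥ 2`, and `M_i` to `M_{i+1}`.

*The quotient `A_n / M_3` is `Ω_*^even`.* In `Ω_*^even` the commutator is `[α, β] = dα ∧ dβ`, a
closed form and therefore a central element, so `x_i ↦ x_i` defines a homomorphism `toOmega` on
`A_n / M_3`. Its inverse comes from the symmetrized product `a ∘ b = (ab + ba) / 2` on `A_n / M_3`,
which is commutative and associative because commutators are central (`SymQuot`), and which
`toOmega` carries to the wedge product. Since `[a, b][b, c] = 0` in `A_n / M_3`, the universal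
property of the even part of the exterior algebra gives a homomorphism `ofForms` from even forms
with the wedge product, `x_i ↦ x_i`, `dx_i ∧ dx_j ↦ [x_i, x_j]`. It is surjective, and
`toOmega ∘ ofForms` is the identity on generators, so `toOmega` is bijective
(`toOmega_bijective`).

*Lifting.* The Lie derivative commutes with `d` and is a derivation of the wedge product, so it is
a derivation of `Ω_*^even`; as the `x_i` generate this algebra, identities between derivations can
be checked on the `x_i`. Derivations of the free algebra may be prescribed freely on generators, so
every `ℒ_v` lifts to `A_n`, and two lifts differ by a derivation with image in `M_3`
(`existsUnique_isInduced`).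

All the gradings are eigenspace decompositions for Euler operators. The Euler derivation of `A_n`
preserves all `L_i` and `M_i`, which are therefore homogeneous subspaces, and it lifts the Euler
vector field. So homogeneous functions have homogeneous preimages in `A_n`
(`exists_homogeneous_preimage`), and a vector field of degree `k` lifts to a derivation of degree
`k` (`exists_homogeneous_lift`).
-/

noncomputable section

namespace LCS

/-! ### Commutator calculus in the lower central series -/

section General

variable {A : Type*} [Ring A] [Algebra ℂ A]

theorem mem_L_one (a : A) : a ∈ L A 1 := LieSubmodule.mem_top a

theorem lie_mem_L {k : ℕ} (a : A) {l : A} (hl : l ∈ L A (k + 1)) : ⁅a, l⁆ ∈ L A (k + 2) := by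
  change _ ∈ LieModule.lowerCentralSeries ℂ A A (k + 1)
  rw [LieModule.lowerCentralSeries_succ]
  exact LieSubmodule.lie_mem_lie (LieSubmodule.mem_top a) hl

theorem lie_mem_L' {k : ℕ} {l : A} (hl : l ∈ L A (k + 1)) (a : A) : ⁅l, a⁆ ∈ L A (k + 2) := by
  rw [← lie_skew]
  exact neg_mem (lie_mem_L a hl)

theorem L_succ_le {k : ℕ} {P : Submodule ℂ A} (h : ∀ a : A, ∀ l ∈ L A (k + 1), ⁅a, l⁆ ∈ P) :
    L A (k + 2) ≤ P := by
  intro x hx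
  change x ∈ LieModule.lowerCentralSeries ℂ A A (k + 1) at hx
  rw [LieModule.lowerCentralSeries_succ, ← LieSubmodule.mem_toSubmodule,
    LieSubmodule.lieIdeal_oper_eq_linear_span'] at hx
  refine Submodule.span_le.mpr ?_ hx
  rintro _ ⟨a, -, l, hl, rfl⟩
  exact h a l hl

theorem L_succ_le_self (k : ℕ) : L A (k + 2) ≤ L A (k + 1) :=
  LieModule.antitone_lowerCentralSeries ℂ A A (Nat.le_succ k)

theorem lie_L_L (j k : ℕ) {x y : A} (hx : x ∈ L A (j + 1)) (hy : y ∈ L A (k + 1)) :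
    ⁅x, y⁆ ∈ L A (j + k + 2) := by
  induction j generalizing k x y with
  | zero => rw [zero_add]; exact lie_mem_L x hy
  | succ j ih =>
    let ad : A →ₗ[ℂ] A := -(LieAlgebra.ad ℂ A y : A →ₗ[ℂ] A)
    have had : ∀ z, ad z = ⁅z, y⁆ := fun z => by
      change -⁅y, z⁆ = _
      rw [lie_skew]
    suffices h : L A (j + 2) ≤ (L A (j + 1 + k + 2)).comap ad by
      simpa only [Submodule.mem_comap, had] using h hx
    refine L_succ_le fun a l hl => ?_
    rw [Submodule.mem_comap, had, lie_lie]
    have h1 : ⁅a, ⁅l, y⁆⁆ ∈ L A (j + k + 3) := lie_mem_L a (ih k hl hy)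
    have h2 : ⁅l, ⁅a, y⁆⁆ ∈ L A (j + (k + 1) + 2) := ih (k + 1) hl (lie_mem_L a hy)
    rw [show j + 1 + k + 2 = j + k + 3 by omega]
    exact sub_mem h1 h2

theorem mem_M_of_mem_L {i : ℕ} {x : A} (hx : x ∈ L A i) : x ∈ M A i :=
  TwoSidedIdeal.mem_asIdeal.mpr (TwoSidedIdeal.subset_span hx)

theorem M_mul_mem_right {i : ℕ} {x : A} (hx : x ∈ M A i) (b : A) : x * b ∈ M A i :=
  Ideal.mul_mem_right b _ hx

/-- Since `l * b = b * l + ⁅l, b⁆`, the ideal `M_i` is already generated by `L_i` as a left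
ideal. -/
theorem M_le {i : ℕ} {P : Submodule ℂ A} (h : ∀ a, ∀ l ∈ L A (i + 1), a * l ∈ P) :
    Mc A (i + 1) ≤ P := by
  suffices h : ∀ x ∈ TwoSidedIdeal.span (L A (i + 1) : Set A), ∀ a b, a * x * b ∈ P by
    intro x hx
    simpa using h x (TwoSidedIdeal.mem_asIdeal.mp hx) 1 1
  intro x hx
  induction hx using TwoSidedIdeal.span_induction with
  | mem x hx =>
    intro a b
    have : a * x * b = a * b * x + a * ⁅x, b⁆ := by rw [Ring.lie_def]; noncomm_ring
    rw [this]
    exact add_mem (h _ _ hx) (h _ _ (L_succ_le_self i (lie_mem_L' hx b)))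
  | zero => intro a b; simp
  | add x y _ _ hx hy => intro a b; rw [mul_add, add_mul]; exact add_mem (hx a b) (hy a b)
  | neg x _ hx => intro a b; rw [mul_neg, neg_mul]; exact neg_mem (hx a b)
  | left_absorb c x _ hx => intro a b; rw [← mul_assoc]; exact hx _ b
  | right_absorb c x _ hx => intro a b; rw [← mul_assoc, mul_assoc]; exact hx a _

theorem M_succ_le_self (i : ℕ) : Mc A (i + 2) ≤ Mc A (i + 1) :=
  M_le fun a _ hl => (M A (i + 1)).mul_mem_left a (mem_M_of_mem_L (L_succ_le_self i hl))

/-- The cyclic identity `[xy, z] + [yz, x] + [zx, y] = 0` moves the products of elements of `L_2`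
out of the bracket. -/
theorem lie_L_two_mul_L_two {x y : A} (hx : x ∈ L A 2) (hy : y ∈ L A 2) (a : A) :
    ⁅x * y, a⁆ ∈ L A 3 := by
  have : ⁅x * y, a⁆ = -⁅y * a, x⁆ - ⁅a * x, y⁆ := by simp only [Ring.lie_def]; noncomm_ring
  rw [this]
  exact sub_mem (neg_mem (lie_mem_L (k := 1) _ hx)) (lie_mem_L (k := 1) _ hy)

/-- The identity `a * ⁅b, m⁆ = ⁅b, a * m⁆ - ⁅b, a⁆ * m` with `m ∈ L_2` writes the elements of `M_3`
as sums of elements of `L_2` and of `L_2 L_2`. -/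
theorem lie_M_three {x : A} (hx : x ∈ M A 3) (y : A) : ⁅x, y⁆ ∈ L A 3 := by
  let ad : A →ₗ[ℂ] A := -(LieAlgebra.ad ℂ A y : A →ₗ[ℂ] A)
  have had : ∀ z, ad z = ⁅z, y⁆ := fun z => by
    change -⁅y, z⁆ = _
    rw [lie_skew]
  suffices h : Mc A 3 ≤ (L A 3).comap ad by
    simpa only [Submodule.mem_comap, had] using h hx
  refine M_le (i := 2) fun a l hl => ?_
  suffices h : L A 3 ≤ ((L A 3).comap ad).comap (LinearMap.mulLeft ℂ a) from h hl
  refine L_succ_le (k := 1) fun b m hm => ?_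
  rw [Submodule.mem_comap, Submodule.mem_comap, had, LinearMap.mulLeft_apply]
  have : ⁅a * ⁅b, m⁆, y⁆ = ⁅⁅b, a * m⁆, y⁆ - ⁅⁅b, a⁆ * m, y⁆ := by
    simp only [Ring.lie_def]; noncomm_ring
  rw [this]
  exact sub_mem (lie_mem_L' (k := 1) (lie_mem_L (k := 0) _ (mem_L_one _)) _)
    (lie_L_two_mul_L_two (lie_mem_L (k := 0) _ (mem_L_one _)) hm y)

/-- `[M_3, L_k] ⊆ L_{k+2}` for `k ≥ 1`; the index `k` is shifted by one here. -/
theorem lie_M_three_L (k : ℕ) {x y : A} (hx : x ∈ M A 3) (hy : y ∈ L A (k + 1)) :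
    ⁅x, y⁆ ∈ L A (k + 3) := by
  induction k generalizing y with
  | zero => exact lie_M_three hx y
  | succ k ih =>
    suffices h : L A (k + 2) ≤ (L A (k + 4)).comap (LieAlgebra.ad ℂ A x : A →ₗ[ℂ] A) from h hy
    refine L_succ_le fun a l hl => ?_
    change ⁅x, ⁅a, l⁆⁆ ∈ L A (k + 4)
    rw [leibniz_lie]
    have h1 := lie_L_L 2 k (lie_M_three hx a) hl
    rw [show 2 + k + 2 = k + 4 by omega] at h1
    exact add_mem h1 (lie_mem_L a (ih hl))

/-- `L_i L_3 ⊆ M_{i+1}` for `i ≥ 2`: modulo `M_{i+1}` the products `l * m` with `l ∈ L_i` and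
`m ∈ L_2` are in `L_i`, since `⁅x, y⁆ * m = ⁅x * m, y⁆ - x * ⁅m, y⁆`, so they commute
with everything. -/
theorem L_mul_L_three (i : ℕ) {x y : A} (hx : x ∈ L A (i + 2)) (hy : y ∈ L A 3) :
    x * y ∈ M A (i + 3) := by
  suffices h : L A 3 ≤ (Mc A (i + 3)).comap (LinearMap.mulLeft ℂ x) from h hy
  refine L_succ_le (k := 1) fun b m hm => ?_
  rw [Submodule.mem_comap, LinearMap.mulLeft_apply]
  suffices h : L A (i + 2) ≤
      (Mc A (i + 3)).comap (LinearMap.mulRight ℂ ⁅b, m⁆) from h hx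
  refine L_succ_le fun a l hl => ?_
  rw [Submodule.mem_comap, LinearMap.mulRight_apply]
  have h1 : ⁅b, ⁅a * m, l⁆⁆ ∈ M A (i + 3) := mem_M_of_mem_L (lie_mem_L b (lie_mem_L _ hl))
  have h2 : ⁅m, l⁆ ∈ M A (i + 3) := by
    have := lie_L_L 1 i hm hl
    rw [show 1 + i + 2 = i + 3 by omega] at this
    exact mem_M_of_mem_L this
  have h3 : ⁅b, ⁅a, l⁆⁆ ∈ M A (i + 3) := mem_M_of_mem_L (lie_mem_L b (lie_mem_L _ hl))
  have : ⁅a, l⁆ * ⁅b, m⁆ =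
      ⁅b, ⁅a * m, l⁆⁆ - (b * (a * ⁅m, l⁆) - a * ⁅m, l⁆ * b) - ⁅b, ⁅a, l⁆⁆ * m := by
    simp only [Ring.lie_def]; noncomm_ring
  rw [this]
  have h4 := (M A (i + 3)).mul_mem_left a h2
  exact sub_mem (sub_mem h1 (sub_mem ((M A (i + 3)).mul_mem_left b h4) (M_mul_mem_right h4 b)))
    (M_mul_mem_right h3 m)

/-- `M_i M_3 ⊆ M_{i+1}` for `i ≥ 2`; the index `i` is shifted by two here. -/
theorem M_mul_M_three (i : ℕ) {x y : A} (hx : x ∈ M A (i + 2)) (hy : y ∈ M A 3) :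
    x * y ∈ M A (i + 3) := by
  suffices h : Mc A (i + 2) ≤ (Mc A (i + 3)).comap (LinearMap.mulRight ℂ y) from h hx
  refine M_le fun a l hl => ?_
  suffices h : Mc A 3 ≤ (Mc A (i + 3)).comap (LinearMap.mulLeft ℂ (a * l)) from h hy
  refine M_le (i := 2) fun b m hm => ?_
  rw [Submodule.mem_comap, LinearMap.mulLeft_apply]
  have : a * l * (b * m) = a * b * (l * m) + a * ⁅l, b⁆ * m := by
    simp only [Ring.lie_def]; noncomm_ring
  rw [this]
  exact add_mem ((M A (i + 3)).mul_mem_left _ (L_mul_L_three i hl hm))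
    (M_mul_mem_right ((M A (i + 3)).mul_mem_left a (mem_M_of_mem_L (lie_mem_L' hl b))) m)

/-- `M_3 M_i ⊆ M_{i+1}` for `i ≥ 2`, with the same shift of the index. -/
theorem M_three_mul_M (i : ℕ) {x y : A} (hx : x ∈ M A (i + 2)) (hy : y ∈ M A 3) :
    y * x ∈ M A (i + 3) := by
  suffices h : Mc A (i + 2) ≤ (Mc A (i + 3)).comap (LinearMap.mulLeft ℂ y) from h hx
  refine M_le fun a l hl => ?_
  rw [Submodule.mem_comap, LinearMap.mulLeft_apply]
  have h1 : l * (y * a) ∈ M A (i + 3) :=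
    M_mul_M_three i (mem_M_of_mem_L hl) (M_mul_mem_right hy a)
  have : y * (a * l) = l * (y * a) - ⁅l, y * a⁆ := by
    simp only [Ring.lie_def]; noncomm_ring
  rw [this]
  exact sub_mem h1 (mem_M_of_mem_L (lie_mem_L' hl _))

/-! ### Derivations with image in `M_3` -/

theorem Der.map_L_of_image (D : Der A) (hD : ∀ a, D.1 a ∈ M A 3) (k : ℕ) :
    ∀ x ∈ L A (k + 2), D.1 x ∈ L A (k + 3) := by
  induction k with
  | zero =>
    refine L_succ_le (k := 0) (P := (L A 3).comap D.1) fun a l _ => ?_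
    rw [Submodule.mem_comap, Der.map_lie]
    exact add_mem (lie_M_three (hD a) l)
      (by rw [← lie_skew]; exact neg_mem (lie_M_three (hD l) a))
  | succ k ih =>
    refine L_succ_le (P := (L A (k + 4)).comap D.1) fun a l hl => ?_
    rw [Submodule.mem_comap, Der.map_lie]
    exact add_mem (lie_M_three_L (k + 1) (hD a) hl) (lie_mem_L a (ih l hl))

theorem Der.map_M_of_image (D : Der A) (hD : ∀ a, D.1 a ∈ M A 3) (k : ℕ) :
    ∀ x ∈ Mc A (k + 1), D.1 x ∈ Mc A (k + 2) := by
  rcases k with _ | k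
  · exact fun x _ => M_succ_le_self 1 (hD x)
  · refine M_le (P := (Mc A (k + 3)).comap D.1) fun a l hl => ?_
    rw [Submodule.mem_comap, Der.leibniz]
    exact add_mem (M_three_mul_M k (mem_M_of_mem_L hl) (hD a))
      ((M A (k + 3)).mul_mem_left a (mem_M_of_mem_L (Der.map_L_of_image D hD k l hl)))

theorem actBbar1_eq_zero (D : Der A) (hD : ∀ a, D.1 a ∈ M A 3) : actBbar1 A D = 0 := by
  refine LinearMap.ext fun x => ?_
  obtain ⟨x, rfl⟩ := Submodule.Quotient.mk_surjective _ x
  obtain ⟨x, rfl⟩ := Submodule.Quotient.mk_surjective _ x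
  exact (Submodule.Quotient.mk_eq_zero _).mpr ⟨actL A 1 D x, hD x.1, rfl⟩

theorem actB_eq_zero (D : Der A) (hD : ∀ a, D.1 a ∈ M A 3) {i : ℕ} (hi : 2 ≤ i) :
    actB A i D = 0 := by
  obtain ⟨k, rfl⟩ := Nat.exists_eq_add_of_le' hi
  refine LinearMap.ext fun x => ?_
  obtain ⟨x, rfl⟩ := Submodule.Quotient.mk_surjective _ x
  exact (Submodule.Quotient.mk_eq_zero _).mpr (Der.map_L_of_image D hD k x.1 x.2)

theorem actN_eq_zero (D : Der A) (hD : ∀ a, D.1 a ∈ M A 3) {i : ℕ} (hi : 1 ≤ i) :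
    actN A i D = 0 := by
  obtain ⟨k, rfl⟩ := Nat.exists_eq_add_of_le' hi
  refine LinearMap.ext fun x => ?_
  obtain ⟨x, rfl⟩ := Submodule.Quotient.mk_surjective _ x
  exact (Submodule.Quotient.mk_eq_zero _).mpr (Der.map_M_of_image D hD k x.1 x.2)

end General

/-! ### Derivations of algebras with given generators -/

section Generators

variable {A : Type*} [Ring A] [Algebra ℂ A]

theorem Der.map_one (D : Der A) : D.1 1 = 0 := by
  have h := Der.leibniz D 1 1
  rw [mul_one, mul_one, one_mul] at h
  exact left_eq_add.mp h

theorem Der.map_algebraMap (D : Der A) (c : ℂ) : D.1 (algebraMap ℂ A c) = 0 := by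
  rw [Algebra.algebraMap_eq_smul_one, map_smul, Der.map_one, smul_zero]

theorem Der.ext_of_adjoin {s : Set A} (hs : Algebra.adjoin ℂ s = ⊤) {D E : Der A}
    (h : ∀ x ∈ s, D.1 x = E.1 x) : D = E := by
  refine Subtype.ext (LinearMap.ext fun a => ?_)
  have ha : a ∈ Algebra.adjoin ℂ s := hs ▸ Algebra.mem_top
  induction ha using Algebra.adjoin_induction with
  | mem x hx => exact h x hx
  | algebraMap r => rw [Der.map_algebraMap, Der.map_algebraMap]
  | add x y _ _ hx hy => rw [map_add, map_add, hx, hy]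
  | mul x y _ _ hx hy => rw [Der.leibniz, Der.leibniz, hx, hy]

variable {n : ℕ}

/-- The derivation of the free algebra with prescribed values `d i` on the generators `x_i`: the
`ε`-part of the homomorphism `x_i ↦ x_i + ε d_i` to the dual numbers over `A_n`. -/
def freeDer (d : Fin n → An n) : Der (An n) :=
  let F : An n →ₐ[ℂ] TrivSqZeroExt (An n) (An n) := FreeAlgebra.lift ℂ fun i =>
    TrivSqZeroExt.inl (FreeAlgebra.ι ℂ i) + TrivSqZeroExt.inr (d i)
  ⟨(TrivSqZeroExt.sndHom (An n) (An n)).restrictScalars ℂ ∘ₗ F.toLinearMap, by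
    have hfst : ∀ a, (F a).fst = a := by
      have : (TrivSqZeroExt.fstHom ℂ (An n) (An n)).comp F = AlgHom.id ℂ _ := by
        refine FreeAlgebra.hom_ext (funext fun i => ?_)
        simp [F]
      exact fun a => DFunLike.congr_fun this a
    intro a b
    change (F (a * b)).snd = (F a).snd * b + a * (F b).snd
    rw [map_mul, TrivSqZeroExt.snd_mul, hfst, hfst, add_comm]
    rfl⟩

theorem freeDer_ι (d : Fin n → An n) (i : Fin n) :
    (freeDer d).1 (FreeAlgebra.ι ℂ i) = d i := by
  change (FreeAlgebra.lift ℂ (fun i => (TrivSqZeroExt.inl (FreeAlgebra.ι ℂ i) +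
    TrivSqZeroExt.inr (d i) : TrivSqZeroExt (An n) (An n))) (FreeAlgebra.ι ℂ i)).snd = _
  rw [FreeAlgebra.lift_ι_apply]
  simp

theorem adjoin_ι_quotient :
    Algebra.adjoin ℂ (Set.range fun i : Fin n =>
      (Ideal.Quotient.mk (M (An n) 3) (FreeAlgebra.ι ℂ i))) = ⊤ := by
  have := congrArg (Subalgebra.map (Ideal.Quotient.mkₐ ℂ (M (An n) 3)))
    (FreeAlgebra.adjoin_range_ι ℂ (Fin n))
  rw [AlgHom.map_adjoin, Algebra.map_top, ← Set.range_comp] at this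
  refine this.trans ?_
  rw [AlgHom.range_eq_top]
  exact Ideal.Quotient.mkₐ_surjective ℂ _

theorem psi_mk (D : Der (An n)) (a : An n) :
    (psi (An n) D).1 (Ideal.Quotient.mk (M (An n) 3) a) = Ideal.Quotient.mk _ (D.1 a) := rfl

theorem psi_surjective : Function.Surjective (psi (An n)) := by
  intro E
  choose d hd using fun i : Fin n =>
    Ideal.Quotient.mk_surjective (E.1 (Ideal.Quotient.mk (M (An n) 3) (FreeAlgebra.ι ℂ i)))
  refine ⟨freeDer d, Der.ext_of_adjoin adjoin_ι_quotient ?_⟩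
  rintro _ ⟨i, rfl⟩
  rw [psi_mk, freeDer_ι, hd]

/-! ### The representations of `W_n` induced by the action of derivations -/

section Induced

variable (φ : (An n ⧸ M (An n) 3) ≃ₐ[ℂ] OmegaStar n) (lam : W n →ₗ⁅ℂ⁆ Der (OmegaStar n))

variable {φ lam} in
theorem IsLift.add {v w : W n} {D E : Der (An n)} (hD : IsLift φ lam v D)
    (hE : IsLift φ lam w E) : IsLift φ lam (v + w) (D + E) := fun q => by
  have h1 := hD q
  have h2 := hE q
  rw [map_add, map_add]
  change φ ((psi (An n) D).1 q + (psi (An n) E).1 q) = (lam v).1 (φ q) + (lam w).1 (φ q)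
  rw [map_add, h1, h2]

variable {φ lam} in
theorem IsLift.smul {v : W n} {D : Der (An n)} (c : ℂ) (hD : IsLift φ lam v D) :
    IsLift φ lam (c • v) (c • D) := fun q => by
  have h1 := hD q
  rw [map_smul, map_smul]
  change φ (c • (psi (An n) D).1 q) = c • (lam v).1 (φ q)
  rw [map_smul, h1]

variable {φ lam} in
theorem IsLift.lie {v w : W n} {D E : Der (An n)} (hD : IsLift φ lam v D)
    (hE : IsLift φ lam w E) : IsLift φ lam ⁅v, w⁆ ⁅D, E⁆ := fun q => by
  rw [LieHom.map_lie, LieHom.map_lie]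
  change φ ((psi (An n) D).1 ((psi (An n) E).1 q) - (psi (An n) E).1 ((psi (An n) D).1 q)) =
    (lam v).1 ((lam w).1 (φ q)) - (lam w).1 ((lam v).1 (φ q))
  rw [map_sub, hD, hE, hE, hD]

theorem isLift_freeDer (v : W n) (d : Fin n → An n)
    (h : ∀ i, φ (Ideal.Quotient.mk _ (d i)) =
      (lam v).1 (φ (Ideal.Quotient.mk _ (FreeAlgebra.ι ℂ i)))) :
    IsLift φ lam v (freeDer d) := by
  intro q
  obtain ⟨a, rfl⟩ := Ideal.Quotient.mk_surjective q
  rw [psi_mk]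
  induction a using FreeAlgebra.induction with
  | grade0 r =>
    have h1 : φ (Ideal.Quotient.mk _ (algebraMap ℂ (An n) r)) = algebraMap ℂ _ r :=
      φ.commutes r
    rw [h1, Der.map_algebraMap, Der.map_algebraMap, map_zero, map_zero]
  | grade1 i => rw [freeDer_ι]; exact h i
  | mul a b ha hb =>
    rw [Der.leibniz, map_add, map_mul, map_mul, map_add, map_mul, map_mul, ha, hb, map_mul,
      map_mul, Der.leibniz]
  | add a b ha hb =>
    rw [map_add, map_add, map_add, map_add, map_add, map_add, ha, hb]

theorem exists_isLift (v : W n) : ∃ D, IsLift φ lam v D := by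
  choose d hd using fun i : Fin n => Ideal.Quotient.mk_surjective
    (φ.symm ((lam v).1 (φ (Ideal.Quotient.mk _ (FreeAlgebra.ι ℂ i)))))
  exact ⟨freeDer d, isLift_freeDer φ lam v d fun i => by rw [hd, AlgEquiv.apply_symm_apply]⟩

/-- A representation of `Der(A_n)` which kills the derivations with image in `M_3` induces a
unique representation of `W_n`: any two lifts of `v` differ by such a derivation. -/
theorem existsUnique_isInduced {V : Type*} [AddCommGroup V] [Module ℂ V]
    (act : Der (An n) →ₗ⁅ℂ⁆ Module.End ℂ V)
    (hact : ∀ D : Der (An n), (∀ a, D.1 a ∈ M (An n) 3) → act D = 0) :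
    ∃ ρ : W n →ₗ⁅ℂ⁆ Module.End ℂ V, IsInduced φ lam act ρ ∧
      ∀ ρ', IsInduced φ lam act ρ' → ρ' = ρ := by
  choose s hs using exists_isLift φ lam
  have key : ∀ v D, IsLift φ lam v D → act (s v) = act D := by
    intro v D hD
    rw [← sub_eq_zero, ← map_sub]
    refine hact _ fun a => ?_
    have h1 := (hs v (Ideal.Quotient.mk _ a)).trans (hD (Ideal.Quotient.mk _ a)).symm
    rw [psi_mk, psi_mk] at h1
    exact Ideal.Quotient.eq.mp (φ.injective h1)
  let ρ : W n →ₗ⁅ℂ⁆ Module.End ℂ V :=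
    { toFun := fun v => act (s v)
      map_add' := fun v w => by
        rw [key _ _ ((hs v).add (hs w)), map_add]
      map_smul' := fun c v => by
        rw [key _ _ ((hs v).smul c), map_smul, RingHom.id_apply]
      map_lie' := fun {v w} => by
        rw [key _ _ ((hs v).lie (hs w)), LieHom.map_lie] }
  exact ⟨ρ, key, fun ρ' hρ' => LieHom.ext fun v => hρ' v _ (hs v)⟩

end Induced

end Generators

/-! ### Commutators of even forms -/

section Forms

variable {n : ℕ}

theorem ι_eq_sum (v : Fin n → ℂ) : ExteriorAlgebra.ι ℂ v = ∑ i, v i • dx n i := by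
  conv_lhs => rw [pi_eq_sum_univ' v]
  rw [map_sum]
  refine Finset.sum_congr rfl fun i _ => ?_
  rw [map_smul, dx]

theorem even_commute {w : Ext n}
    (hw : w ∈ CliffordAlgebra.even (0 : QuadraticForm ℂ (Fin n → ℂ))) (u : Ext n) :
    u * w = w * u := by
  induction u using ExteriorAlgebra.induction with
  | algebraMap r => exact Algebra.commutes r w
  | ι v =>
    rw [ι_eq_sum, Finset.sum_mul, Finset.mul_sum]
    simp only [smul_mul_assoc, mul_smul_comm, dx_comm_even _ w hw]
  | mul a b ha hb => rw [mul_assoc, hb, ← mul_assoc, ha, mul_assoc]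
  | add a b ha hb => rw [add_mul, mul_add, ha, hb]

/-- Even forms are central for the wedge product. -/
theorem evenForms_commute {a : Forms n} (ha : a ∈ evenForms n) (b : Forms n) : b * a = a * b := by
  refine even_induction (p := fun a => b * a = a * b) (fun f w hw => ?_) (fun x y hx hy => ?_) a ha
  · induction b using TensorProduct.induction_on with
    | zero => simp
    | tmul g u =>
      rw [Algebra.TensorProduct.tmul_mul_tmul, Algebra.TensorProduct.tmul_mul_tmul, mul_comm g,
        even_commute hw]
    | add x y hx hy => rw [add_mul, mul_add, hx, hy]
  · rw [mul_add, add_mul, hx, hy]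

theorem deRham_anticomm {a b : Forms n} (ha : a ∈ evenForms n) (hb : b ∈ evenForms n) :
    deRham n b * deRham n a = -(deRham n a * deRham n b) := by
  have h := congrArg (deRham n) (evenForms_commute ha (deRham n b))
  rw [deRham_deRham_mul hb, deRham_mul ha, deRham_deRham, mul_zero, add_zero] at h
  rw [← h, neg_neg]

theorem OmegaStar.form_sub (a b : OmegaStar n) : (a - b).form = a.form - b.form := rfl

theorem OmegaStar.form_sum {ι : Type*} (s : Finset ι) (f : ι → OmegaStar n) :
    (∑ i ∈ s, f i).form = ∑ i ∈ s, (f i).form :=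
  map_sum (AddMonoidHom.mk' (OmegaStar.form : OmegaStar n → Forms n) OmegaStar.form_add) f s

theorem OmegaStar.form_lie (a b : OmegaStar n) :
    ⁅a, b⁆.form = deRham n a.form * deRham n b.form := by
  rw [Ring.lie_def, OmegaStar.form_sub, OmegaStar.form_mul, OmegaStar.form_mul,
    evenForms_commute a.form_mem, deRham_anticomm a.form_mem b.form_mem, smul_neg]
  rw [add_sub_add_left_eq_sub, sub_neg_eq_add, ← add_smul]
  norm_num

theorem OmegaStar.form_symm_mul (a b : OmegaStar n) :
    ((1 / 2 : ℂ) • (a * b + b * a)).form = a.form * b.form := by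
  rw [OmegaStar.form_smul, OmegaStar.form_add, OmegaStar.form_mul, OmegaStar.form_mul,
    evenForms_commute a.form_mem, deRham_anticomm a.form_mem b.form_mem, smul_neg]
  rw [add_add_add_comm, add_neg_cancel, add_zero, ← two_smul ℂ, smul_smul]
  norm_num

/-- `[α, β] = dα ∧ dβ` is closed, so it commutes with everything. -/
theorem OmegaStar.lie_lie (a b c : OmegaStar n) : ⁅a, ⁅b, c⁆⁆ = 0 := by
  ext
  rw [OmegaStar.form_lie, OmegaStar.form_lie, deRham_deRham_mul b.form_mem, deRham_deRham,
    mul_zero, neg_zero, mul_zero, OmegaStar.form_zero]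

end Forms

/-! ### The symmetrized product on `A / M_3` -/

section Symm

variable (A : Type*) [Ring A] [Algebra ℂ A]

theorem lie_lie_quotient (a b c : A ⧸ M A 3) : ⁅a, ⁅b, c⁆⁆ = 0 := by
  obtain ⟨a, rfl⟩ := Ideal.Quotient.mk_surjective a
  obtain ⟨b, rfl⟩ := Ideal.Quotient.mk_surjective b
  obtain ⟨c, rfl⟩ := Ideal.Quotient.mk_surjective c
  have : Ideal.Quotient.mk (M A 3) ⁅a, ⁅b, c⁆⁆ = 0 := Ideal.Quotient.eq_zero_iff_mem.mpr
    (mem_M_of_mem_L (lie_mem_L (k := 1) a (lie_mem_L (k := 0) b (mem_L_one c))))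
  simpa only [Ring.lie_def, map_sub, map_mul] using this

/-- The algebra `A / M_3` with the product `a ∘ b = (ab + ba) / 2`. It is commutative, and it is
associative since `(a ∘ b) ∘ c - a ∘ (b ∘ c) = [b, [a, c]] / 4`. -/
def SymQuot : Type _ := A ⧸ M A 3

namespace SymQuot

variable {A}

/-- The element of `A / M_3` underlying an element of `SymQuot A`. -/
def val (a : SymQuot A) : A ⧸ M A 3 := a

/-- An element of `A / M_3` as an element of `SymQuot A`. -/
def of (a : A ⧸ M A 3) : SymQuot A := a

instance : AddCommGroup (SymQuot A) := inferInstanceAs (AddCommGroup (A ⧸ M A 3))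

instance : Module ℂ (SymQuot A) := inferInstanceAs (Module ℂ (A ⧸ M A 3))

instance : Mul (SymQuot A) where
  mul a b := of ((1 / 2 : ℂ) • (a.val * b.val + b.val * a.val))

instance : One (SymQuot A) where
  one := of 1

@[ext] theorem ext {a b : SymQuot A} (h : a.val = b.val) : a = b := h

theorem val_of (a : A ⧸ M A 3) : (of a).val = a := rfl

theorem val_mul (a b : SymQuot A) :
    (a * b).val = (1 / 2 : ℂ) • (a.val * b.val + b.val * a.val) := rfl

theorem val_one : (1 : SymQuot A).val = 1 := rfl

theorem val_zero : (0 : SymQuot A).val = 0 := rfl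

theorem val_add (a b : SymQuot A) : (a + b).val = a.val + b.val := rfl

theorem val_smul (c : ℂ) (a : SymQuot A) : (c • a).val = c • a.val := rfl

instance : CommRing (SymQuot A) :=
  { (inferInstance : AddCommGroup (SymQuot A)), (inferInstance : Mul (SymQuot A)),
    (inferInstance : One (SymQuot A)) with
    left_distrib := fun a b c => by
      ext; simp only [val_mul, val_add, mul_add, add_mul, ← smul_add]; congr 1; abel
    right_distrib := fun a b c => by
      ext; simp only [val_mul, val_add, mul_add, add_mul, ← smul_add]; congr 1; abel
    zero_mul := fun a => by ext; simp [val_mul, val_zero]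
    mul_zero := fun a => by ext; simp [val_mul, val_zero]
    one_mul := fun a => by
      ext; rw [val_mul, val_one, one_mul, mul_one, ← two_smul ℂ, smul_smul]; norm_num
    mul_one := fun a => by
      ext; rw [val_mul, val_one, one_mul, mul_one, ← two_smul ℂ, smul_smul]; norm_num
    mul_comm := fun a b => by ext; rw [val_mul, val_mul, add_comm]
    mul_assoc := fun a b c => by
      ext
      have h := lie_lie_quotient A b.val a.val c.val
      simp only [val_mul, smul_mul_assoc, mul_smul_comm, ← smul_add]
      congr 2
      rw [← sub_eq_zero, ← h]
      simp only [Ring.lie_def]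
      noncomm_ring }

instance : Algebra ℂ (SymQuot A) :=
  Algebra.ofModule
    (fun c a b => by
      ext
      simp only [val_mul, val_smul, smul_mul_assoc, mul_smul_comm, ← smul_add, smul_comm c])
    (fun c a b => by
      ext
      simp only [val_mul, val_smul, smul_mul_assoc, mul_smul_comm, ← smul_add, smul_comm c])

/-- The product of `A / M_3` in terms of the symmetrized product. -/
theorem val_mul_val (a b : SymQuot A) :
    a.val * b.val = (a * b).val + (1 / 2 : ℂ) • ⁅a.val, b.val⁆ := by
  rw [val_mul, ← smul_add, Ring.lie_def, add_add_sub_cancel, ← two_smul ℂ, smul_smul]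
  norm_num

/-- The bracket with `a` is a derivation of the symmetrized product. -/
theorem lie_val_mul (a : A ⧸ M A 3) (b c : SymQuot A) :
    of ⁅a, (b * c).val⁆ = of ⁅a, b.val⁆ * c + b * of ⁅a, c.val⁆ := by
  ext
  simp only [val_mul, val_add, val_of, ← smul_add, Ring.lie_def, mul_smul_comm, smul_mul_assoc,
    ← smul_sub]
  congr 1
  noncomm_ring

end SymQuot

variable {A} in
/-- Commutators are central in `A / M_3`, so `0 = ⁅⁅a * b, c⁆, b⁆ = ⁅a, b⁆ * ⁅b, c⁆`. -/
theorem lie_mul_lie_quotient (a b c : A ⧸ M A 3) : ⁅a, b⁆ * ⁅b, c⁆ = 0 := by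
  have h1 := lie_lie_quotient A b (a * b) c
  have h2 := lie_lie_quotient A b b c
  have h3 := lie_lie_quotient A b a c
  have : ⁅a, b⁆ * ⁅b, c⁆ = a * ⁅b, ⁅b, c⁆⁆ + ⁅b, ⁅a, c⁆⁆ * b - ⁅b, ⁅a * b, c⁆⁆ := by
    simp only [Ring.lie_def]; noncomm_ring
  rw [this, h1, h2, h3]
  simp

end Symm

/-! ### The isomorphism `A_n / M_3 ≅ Ω_*^even` -/

section Iso

variable {n : ℕ}

theorem map_M_three_eq_zero {A S : Type*} [Ring A] [Algebra ℂ A] [Ring S] [Algebra ℂ S]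
    (f : A →ₐ[ℂ] S) (hS : ∀ a b c : S, ⁅a, ⁅b, c⁆⁆ = 0) {x : A} (hx : x ∈ M A 3) : f x = 0 := by
  suffices h : Mc A 3 ≤ LinearMap.ker f.toLinearMap from h hx
  refine M_le (i := 2) fun a l hl => ?_
  have hl' : l ∈ LinearMap.ker f.toLinearMap := by
    suffices h : L A 3 ≤ LinearMap.ker f.toLinearMap from h hl
    refine L_succ_le (k := 1) fun b m hm => ?_
    suffices h : L A 2 ≤ (LinearMap.ker f.toLinearMap).comap (LieAlgebra.ad ℂ A b : A →ₗ[ℂ] A) from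
      h hm
    refine L_succ_le (k := 0) fun c e _ => ?_
    change f ⁅b, ⁅c, e⁆⁆ = 0
    simpa only [Ring.lie_def, map_sub, map_mul] using hS (f b) (f c) (f e)
  change f (a * l) = 0
  rw [map_mul, show f l = 0 from hl', mul_zero]

variable (n)

/-- The homomorphism `A_n / M_3 → Ω_*^even` with `x_i ↦ x_i`. -/
def toOmega : (An n ⧸ M (An n) 3) →ₐ[ℂ] OmegaStar n :=
  AlgHom.mk (Ideal.Quotient.lift (M (An n) 3)
      (FreeAlgebra.lift ℂ OmegaStar.x : An n →ₐ[ℂ] OmegaStar n).toRingHom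
      (fun _ h => map_M_three_eq_zero _ OmegaStar.lie_lie h))
    (fun r => AlgHom.commutes (FreeAlgebra.lift ℂ OmegaStar.x : An n →ₐ[ℂ] OmegaStar n) r)

/-- The image of `x_i` in `A_n / M_3`. -/
def genQuot (i : Fin n) : An n ⧸ M (An n) 3 := Ideal.Quotient.mk _ (FreeAlgebra.ι ℂ i)

variable {n}

theorem toOmega_gen (i : Fin n) : toOmega n (genQuot n i) = OmegaStar.x i :=
  FreeAlgebra.lift_ι_apply _ _

variable (n)

/-- The linear forms in the generators of `A_n / M_3`. -/
def linQuot : (Fin n → ℂ) →ₗ[ℂ] An n ⧸ M (An n) 3 := Fintype.linearCombination ℂ (genQuot n)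

variable {n}

theorem linQuot_single (i : Fin n) : linQuot n (Pi.single i 1) = genQuot n i := by
  rw [linQuot, Fintype.linearCombination_apply_single, one_smul]

theorem deRham_toOmega_linQuot (v : Fin n → ℂ) :
    deRham n (toOmega n (linQuot n v)).form = 1 ⊗ₜ ExteriorAlgebra.ι ℂ v := by
  rw [linQuot, Fintype.linearCombination_apply, map_sum, OmegaStar.form_sum, map_sum, ι_eq_sum,
    TensorProduct.tmul_sum]
  refine Finset.sum_congr rfl fun i _ => ?_
  rw [map_smul, OmegaStar.form_smul, map_smul, TensorProduct.tmul_smul, toOmega_gen]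
  congr 1
  change deRham n (MvPolynomial.X i ⊗ₜ 1) = _
  rw [deRham_tmul, Finset.sum_eq_single i]
  · rw [MvPolynomial.pderiv_X_self, mul_one]
  · intro j _ hj
    rw [MvPolynomial.pderiv_X_of_ne (Ne.symm hj), TensorProduct.zero_tmul]
  · simp

variable (n)

/-- The assignment `ι_a ι_b ↦ [a, b]` on even elements of the exterior algebra. -/
def lieEvenHom : CliffordAlgebra.EvenHom (0 : QuadraticForm ℂ (Fin n → ℂ)) (SymQuot (An n)) where
  bilin := LinearMap.mk₂ ℂ (fun a b => SymQuot.of ⁅linQuot n a, linQuot n b⁆)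
    (fun a a' b => by simp only [map_add, add_lie]; rfl)
    (fun c a b => by
      simp only [map_smul, Ring.lie_def, smul_mul_assoc, mul_smul_comm, ← smul_sub]; rfl)
    (fun a b b' => by simp only [map_add, lie_add]; rfl)
    (fun c a b => by
      simp only [map_smul, Ring.lie_def, smul_mul_assoc, mul_smul_comm, ← smul_sub]; rfl)
  contract a := by
    rw [LinearMap.mk₂_apply, lie_self, zero_apply, map_zero]
    rfl
  contract_mid a b c := by
    simp only [LinearMap.mk₂_apply, zero_apply, zero_smul]
    ext
    rw [SymQuot.val_mul, SymQuot.val_of, SymQuot.val_of, lie_mul_lie_quotient,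
      ← sub_add_cancel (⁅linQuot n b, linQuot n c⁆ * ⁅linQuot n a, linQuot n b⁆)
        (⁅linQuot n a, linQuot n b⁆ * ⁅linQuot n b, linQuot n c⁆), ← Ring.lie_def,
      lie_lie_quotient, lie_mul_lie_quotient]
    simp [SymQuot.val_zero]

/-- The homomorphism from even forms to `A_n / M_3` with the symmetrized product, which sends
`x_i` to `x_i` and `dx_i ∧ dx_j` to `[x_i, x_j]`. -/
def ofForms : Poly n ⊗[ℂ] CliffordAlgebra.even (0 : QuadraticForm ℂ (Fin n → ℂ)) →ₐ[ℂ]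
    SymQuot (An n) :=
  Algebra.TensorProduct.productMap (MvPolynomial.aeval fun i => SymQuot.of (genQuot n i))
    (CliffordAlgebra.even.lift _ (lieEvenHom n))

theorem ofForms_even_ι (a b : Fin n → ℂ) :
    ofForms n (1 ⊗ₜ (CliffordAlgebra.even.ι _).bilin a b) =
      SymQuot.of ⁅linQuot n a, linQuot n b⁆ := by
  rw [ofForms, Algebra.TensorProduct.productMap_apply_tmul, map_one, one_mul,
    CliffordAlgebra.even.lift_ι]
  rfl

theorem ofForms_X (i : Fin n) :
    ofForms n (MvPolynomial.X i ⊗ₜ 1) = SymQuot.of (genQuot n i) := by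
  rw [ofForms, Algebra.TensorProduct.productMap_apply_tmul, map_one, mul_one,
    MvPolynomial.aeval_X]

/-- `toOmega` as a homomorphism from the symmetrized product to the wedge product. -/
def symToForms : SymQuot (An n) →ₐ[ℂ] Forms n :=
  AlgHom.ofLinearMap
    { toFun := fun a => (toOmega n a.val).form
      map_add' := fun a b => by rw [SymQuot.val_add, map_add, OmegaStar.form_add]
      map_smul' := fun c a => by
        rw [SymQuot.val_smul, map_smul, OmegaStar.form_smul, RingHom.id_apply] }
    (by
      change (toOmega n 1).form = 1
      rw [map_one, OmegaStar.form_one])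
    (fun a b => by
      change (toOmega n (a * b).val).form = (toOmega n a.val).form * (toOmega n b.val).form
      rw [SymQuot.val_mul, map_smul, map_add, map_mul, map_mul, OmegaStar.form_symm_mul])

theorem symToForms_apply (a : SymQuot (An n)) : symToForms n a = (toOmega n a.val).form := rfl

theorem symToForms_comp_ofForms : (symToForms n).comp (ofForms n) =
    Algebra.TensorProduct.map (AlgHom.id ℂ (Poly n))
      (CliffordAlgebra.even (0 : QuadraticForm ℂ (Fin n → ℂ))).val := by
  refine Algebra.TensorProduct.ext ?_ ?_
  · refine MvPolynomial.algHom_ext fun i => ?_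
    change symToForms n (ofForms n (MvPolynomial.X i ⊗ₜ 1)) = MvPolynomial.X i ⊗ₜ 1
    rw [ofForms_X, symToForms_apply, SymQuot.val_of, toOmega_gen]
    rfl
  · refine CliffordAlgebra.even.algHom_ext _ (CliffordAlgebra.EvenHom.ext ?_)
    refine LinearMap.ext₂ fun a b => ?_
    change symToForms n (ofForms n (1 ⊗ₜ (CliffordAlgebra.even.ι _).bilin a b)) =
      1 ⊗ₜ (ExteriorAlgebra.ι ℂ a * ExteriorAlgebra.ι ℂ b)
    rw [ofForms_even_ι, symToForms_apply, SymQuot.val_of, Ring.lie_def, map_sub, map_mul, map_mul,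
      ← Ring.lie_def, OmegaStar.form_lie, deRham_toOmega_linQuot, deRham_toOmega_linQuot,
      Algebra.TensorProduct.tmul_mul_tmul, one_mul]

theorem form_toOmega_ofForms
    (t : Poly n ⊗[ℂ] CliffordAlgebra.even (0 : QuadraticForm ℂ (Fin n → ℂ))) :
    (toOmega n (ofForms n t).val).form = Algebra.TensorProduct.map (AlgHom.id ℂ (Poly n))
      (CliffordAlgebra.even (0 : QuadraticForm ℂ (Fin n → ℂ))).val t :=
  DFunLike.congr_fun (symToForms_comp_ofForms n) t

theorem SymQuot.lie_algebraMap (a : An n ⧸ M (An n) 3) (r : ℂ) :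
    ⁅a, (algebraMap ℂ (SymQuot (An n)) r).val⁆ = 0 := by
  rw [Algebra.algebraMap_eq_smul_one, SymQuot.val_smul, SymQuot.val_one, Ring.lie_def,
    mul_smul_comm, smul_mul_assoc, one_mul, mul_one, sub_self]

theorem even_subalgebra_induction
    {p : CliffordAlgebra.even (0 : QuadraticForm ℂ (Fin n → ℂ)) → Prop}
    (algebraMap : ∀ r : ℂ, p (algebraMap ℂ _ r))
    (add : ∀ x y, p x → p y → p (x + y))
    (ι_mul : ∀ a b x, p x → p ((CliffordAlgebra.even.ι _).bilin a b * x))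
    (w : CliffordAlgebra.even (0 : QuadraticForm ℂ (Fin n → ℂ))) : p w :=
  CliffordAlgebra.even_induction (0 : QuadraticForm ℂ (Fin n → ℂ))
    (motive := fun w hw => p ⟨w, hw⟩) algebraMap (fun _ _ _ _ h1 h2 => add _ _ h1 h2)
    (fun a b _ _ h => ι_mul a b _ h) w.1 w.2

/-- The even forms with constant coefficients correspond to central elements. -/
theorem lie_ofForms_const (a : An n ⧸ M (An n) 3)
    (w : CliffordAlgebra.even (0 : QuadraticForm ℂ (Fin n → ℂ))) :
    SymQuot.of ⁅a, (ofForms n (1 ⊗ₜ w)).val⁆ = 0 := by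
  induction w using even_subalgebra_induction with
  | algebraMap r =>
    rw [ofForms, Algebra.TensorProduct.productMap_apply_tmul, map_one, one_mul, AlgHom.commutes,
      SymQuot.lie_algebraMap]
    rfl
  | add x y hx hy =>
    have h : ∀ b c : SymQuot (An n),
        SymQuot.of ⁅a, (b + c).val⁆ = SymQuot.of ⁅a, b.val⁆ + SymQuot.of ⁅a, c.val⁆ :=
      fun b c => lie_add a b.val c.val
    rw [TensorProduct.tmul_add, map_add, h, hx, hy, add_zero]
  | ι_mul b c x hx =>
    rw [← one_mul (1 : Poly n), ← Algebra.TensorProduct.tmul_mul_tmul, map_mul,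
      SymQuot.lie_val_mul, hx, ofForms_even_ι, SymQuot.val_of, lie_lie_quotient, mul_zero,
      add_zero]
    exact zero_mul _

theorem lie_gen_mem_range (i : Fin n) {q : SymQuot (An n)} (hq : q ∈ (ofForms n).range) :
    SymQuot.of ⁅genQuot n i, q.val⁆ ∈ (ofForms n).range := by
  obtain ⟨t, rfl⟩ := hq
  have hrange : ∀ t, ofForms n t ∈ (ofForms n).range := fun t => ⟨t, rfl⟩
  have hzero : SymQuot.of (0 : An n ⧸ M (An n) 3) ∈ (ofForms n).range := zero_mem _
  change SymQuot.of ⁅genQuot n i, (ofForms n t).val⁆ ∈ _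
  induction t using TensorProduct.induction_on with
  | zero => rw [map_zero, SymQuot.val_zero, lie_zero]; exact hzero
  | add x y hx hy => rw [map_add, SymQuot.val_add, lie_add]; exact add_mem hx hy
  | tmul f w =>
    have h : (f ⊗ₜ w : Poly n ⊗[ℂ] CliffordAlgebra.even (0 : QuadraticForm ℂ (Fin n → ℂ))) =
      f ⊗ₜ 1 * 1 ⊗ₜ w := by rw [Algebra.TensorProduct.tmul_mul_tmul, mul_one, one_mul]
    rw [h, map_mul, SymQuot.lie_val_mul, lie_ofForms_const]
    refine add_mem (mul_mem ?_ (hrange _)) (mul_mem (hrange _) (zero_mem _))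
    clear h
    induction f using MvPolynomial.induction_on with
    | C r =>
      have h : ofForms n (MvPolynomial.C r ⊗ₜ 1) = algebraMap ℂ _ r := by
        rw [ofForms, Algebra.TensorProduct.productMap_apply_tmul, map_one, mul_one,
          MvPolynomial.aeval_C]
      rw [h, SymQuot.lie_algebraMap]
      exact hzero
    | add x y hx hy =>
      rw [TensorProduct.add_tmul, map_add, SymQuot.val_add, lie_add]
      exact add_mem (hx) (hy)
    | mul_X f j hf =>
      have h : ((f * MvPolynomial.X j) ⊗ₜ 1 :
          Poly n ⊗[ℂ] CliffordAlgebra.even (0 : QuadraticForm ℂ (Fin n → ℂ))) =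
          f ⊗ₜ 1 * MvPolynomial.X j ⊗ₜ 1 := by
        rw [Algebra.TensorProduct.tmul_mul_tmul, one_mul]
      rw [h, map_mul, SymQuot.lie_val_mul, ofForms_X]
      refine add_mem (mul_mem (hf) ⟨_, ofForms_X n j⟩) (mul_mem (hrange _) ?_)
      rw [SymQuot.val_of, ← linQuot_single, ← linQuot_single, ← ofForms_even_ι]
      exact hrange _

/-- The range contains `1` and is stable under left multiplication by the generators `x_i` of
`A_n / M_3`, because `x_i * q = x_i ∘ q + ⁅x_i, q⁆ / 2`. -/
theorem ofForms_surjective : Function.Surjective (ofForms n) := by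
  have key : ∀ (a : An n) (q : SymQuot (An n)), q ∈ (ofForms n).range →
      SymQuot.of (Ideal.Quotient.mk (M (An n) 3) a * q.val) ∈ (ofForms n).range := by
    intro a
    induction a using FreeAlgebra.induction with
    | grade0 r =>
      intro q hq
      have h : Ideal.Quotient.mk (M (An n) 3) (algebraMap ℂ (An n) r) * q.val = r • q.val :=
        (Algebra.smul_def r q.val).symm
      rw [h]
      exact Subalgebra.smul_mem _ hq r
    | grade1 i =>
      intro q hq
      have h := SymQuot.val_mul_val (SymQuot.of (genQuot n i)) q
      change SymQuot.of ((SymQuot.of (genQuot n i)).val * q.val) ∈ _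
      rw [h]
      exact add_mem (mul_mem (⟨_, ofForms_X n i⟩ : _ ∈ (ofForms n).range) hq)
        (Subalgebra.smul_mem _ (lie_gen_mem_range n i hq) _)
    | mul a b ha hb =>
      intro q hq
      rw [map_mul, mul_assoc]
      exact ha _ (hb q hq)
    | add a b ha hb =>
      intro q hq
      rw [map_add, add_mul]
      exact add_mem (ha q hq) (hb q hq)
  intro q
  obtain ⟨a, ha⟩ := Ideal.Quotient.mk_surjective (I := M (An n) 3) q.val
  have h := key a 1 (one_mem _)
  rw [ha, SymQuot.val_one, mul_one] at h
  exact h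

theorem toOmega_bijective : Function.Bijective (toOmega n) := by
  constructor
  · intro a b hab
    obtain ⟨s, hs⟩ := ofForms_surjective n (SymQuot.of a)
    obtain ⟨t, ht⟩ := ofForms_surjective n (SymQuot.of b)
    have h : Function.Injective (Algebra.TensorProduct.map (AlgHom.id ℂ (Poly n))
        (CliffordAlgebra.even (0 : QuadraticForm ℂ (Fin n → ℂ))).val) :=
      Module.Flat.lTensor_preserves_injective_linearMap (M := Poly n)
        (CliffordAlgebra.even (0 : QuadraticForm ℂ (Fin n → ℂ))).val.toLinearMap
        Subtype.val_injective
    have h2 : s = t := h (by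
      rw [← form_toOmega_ofForms, ← form_toOmega_ofForms, hs, ht]
      exact congrArg OmegaStar.form hab)
    change SymQuot.of a = SymQuot.of b
    rw [← hs, ← ht, h2]
  · intro b
    obtain ⟨t, ht⟩ := b.form_mem
    exact ⟨(ofForms n t).val, OmegaStar.ext ((form_toOmega_ofForms n t).trans ht)⟩

/-- The algebra isomorphism `A_n / M_3 ≅ Ω_*^even`, `x_i ↦ x_i`. -/
def omegaEquiv : (An n ⧸ M (An n) 3) ≃ₐ[ℂ] OmegaStar n :=
  AlgEquiv.ofBijective (toOmega n) (toOmega_bijective n)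

end Iso

/-! ### The Lie derivative -/

section Lie

variable {n : ℕ}

/-- The operator `dx_j ∧ ι_{∂_i}` on constant forms. -/
def wedgeContract (j i : Fin n) : Ext n →ₗ[ℂ] Ext n :=
  LinearMap.mulLeft ℂ (dx n j) ∘ₗ
    CliffordAlgebra.contractLeft (Q := (0 : QuadraticForm ℂ (Fin n → ℂ))) (LinearMap.proj i)

theorem wedgeContract_apply (j i : Fin n) (w : Ext n) : wedgeContract j i w =
    dx n j * CliffordAlgebra.contractLeft (Q := (0 : QuadraticForm ℂ (Fin n → ℂ)))
      (LinearMap.proj i) w := rfl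

theorem wedgeContract_ι_mul (j i : Fin n) (v : Fin n → ℂ) (w : Ext n) :
    wedgeContract j i (ExteriorAlgebra.ι ℂ v * w) =
      v i • (dx n j * w) + ExteriorAlgebra.ι ℂ v * wedgeContract j i w := by
  rw [wedgeContract_apply, wedgeContract_apply, ExteriorAlgebra.ι,
    CliffordAlgebra.contractLeft_ι_mul, mul_sub, mul_smul_comm, ← mul_assoc, ← mul_assoc,
    LinearMap.proj_apply]
  have : dx n j * CliffordAlgebra.ι 0 v = -(CliffordAlgebra.ι 0 v * dx n j) :=
    eq_neg_of_add_eq_zero_left (ExteriorAlgebra.ι_add_mul_swap _ _)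
  rw [this, neg_mul, sub_neg_eq_add]

theorem wedgeContract_one (j i : Fin n) : wedgeContract j i 1 = 0 := by
  rw [wedgeContract_apply, CliffordAlgebra.contractLeft_one, mul_zero]

/-- Although `ι_{∂_i}` is an odd derivation, `dx_j ∧ ι_{∂_i}` is an even one. -/
theorem wedgeContract_mul (j i : Fin n) (u w : Ext n) :
    wedgeContract j i (u * w) = wedgeContract j i u * w + u * wedgeContract j i w := by
  induction u using CliffordAlgebra.left_induction generalizing w with
  | algebraMap r =>
    rw [Algebra.algebraMap_eq_smul_one, smul_mul_assoc, one_mul, map_smul, map_smul,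
      wedgeContract_one, smul_zero, zero_mul, zero_add, smul_mul_assoc, one_mul]
  | add x y hx hy => rw [add_mul, map_add, map_add, hx, hy]; simp only [add_mul]; abel
  | ι_mul x m hx =>
    change wedgeContract j i (ExteriorAlgebra.ι ℂ m * x * w) =
      wedgeContract j i (ExteriorAlgebra.ι ℂ m * x) * w +
        ExteriorAlgebra.ι ℂ m * x * wedgeContract j i w
    rw [mul_assoc, wedgeContract_ι_mul, hx, wedgeContract_ι_mul]
    simp only [add_mul, mul_add, smul_mul_assoc, mul_assoc]
    abel

theorem wedgeContract_mem_even (j i : Fin n) (w : Ext n)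
    (hw : w ∈ CliffordAlgebra.even (0 : QuadraticForm ℂ (Fin n → ℂ))) :
    wedgeContract j i w ∈ CliffordAlgebra.even (0 : QuadraticForm ℂ (Fin n → ℂ)) := by
  have hι : ∀ a b : Fin n → ℂ, ExteriorAlgebra.ι ℂ a * ExteriorAlgebra.ι ℂ b ∈
      CliffordAlgebra.even (0 : QuadraticForm ℂ (Fin n → ℂ)) :=
    fun a b => CliffordAlgebra.ι_mul_ι_mem_evenOdd_zero _ _ _
  refine CliffordAlgebra.even_induction (0 : QuadraticForm ℂ (Fin n → ℂ))
    (motive := fun w _ => wedgeContract j i w ∈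
      CliffordAlgebra.even (0 : QuadraticForm ℂ (Fin n → ℂ))) ?_ ?_ ?_ w hw
  · intro r
    rw [Algebra.algebraMap_eq_smul_one, map_smul, wedgeContract_one, smul_zero]
    exact zero_mem _
  · intro x y _ _ hx hy; rw [map_add]; exact add_mem hx hy
  · intro a b x hx h
    change wedgeContract j i (ExteriorAlgebra.ι ℂ a * ExteriorAlgebra.ι ℂ b * x) ∈ _
    rw [wedgeContract_mul]
    refine add_mem (mul_mem ?_ hx) (mul_mem (hι a b) h)
    have h1 := wedgeContract_ι_mul j i b 1
    rw [mul_one, mul_one, wedgeContract_one, mul_zero, add_zero] at h1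
    rw [wedgeContract_ι_mul, h1, mul_smul_comm]
    exact add_mem (Subalgebra.smul_mem _ (hι _ _) _) (Subalgebra.smul_mem _ (hι _ _) _)

theorem contractLeft_dx_mul (j i : Fin n) (w : Ext n) :
    CliffordAlgebra.contractLeft (Q := (0 : QuadraticForm ℂ (Fin n → ℂ))) (LinearMap.proj i)
      (dx n j * w) = (if j = i then w else 0) - wedgeContract j i w := by
  rw [wedgeContract_apply, dx, ExteriorAlgebra.ι, CliffordAlgebra.contractLeft_ι_mul,
    LinearMap.proj_apply, Pi.single_apply]
  split_ifs with h1 h2 h2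
  · rw [one_smul]
  · exact absurd h1.symm h2
  · exact absurd h2.symm h1
  · rw [zero_smul]

theorem derivation_sum_apply {ι : Type*} (s : Finset ι) (v : ι → W n) (f : Poly n) :
    (∑ i ∈ s, v i) f = ∑ i ∈ s, v i f :=
  map_sum (AddMonoidHom.mk' (fun v : W n => v f) fun _ _ => rfl) v s

theorem derivation_eq_sum_pderiv (v : W n) (f : Poly n) :
    v f = ∑ i, v (MvPolynomial.X i) * MvPolynomial.pderiv i f := by
  have h : v = ∑ i, v (MvPolynomial.X i) • MvPolynomial.pderiv i := by
    refine MvPolynomial.derivation_ext fun j => ?_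
    rw [derivation_sum_apply, Finset.sum_eq_single j]
    · rw [Derivation.smul_apply, MvPolynomial.pderiv_X_self, smul_eq_mul, mul_one]
    · intro i _ hi
      rw [Derivation.smul_apply, MvPolynomial.pderiv_X_of_ne hi.symm, smul_zero]
    · simp
  conv_lhs => rw [h]
  rw [derivation_sum_apply]
  rfl

/-- Cartan's formula for the Lie derivative in coordinates. -/
theorem lieDerivative_tmul (v : W n) (f : Poly n) (w : Ext n) :
    lieDerivative v (f ⊗ₜ w) = v f ⊗ₜ w + ∑ i, ∑ j,
      (MvPolynomial.pderiv j (v (MvPolynomial.X i)) * f) ⊗ₜ wedgeContract j i w := by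
  have h1 : deRham n (interiorProduct v (f ⊗ₜ w)) = ∑ i, ∑ j,
      (MvPolynomial.pderiv j (v (MvPolynomial.X i)) * f) ⊗ₜ[ℂ] wedgeContract j i w +
      ∑ i, ∑ j, (v (MvPolynomial.X i) * MvPolynomial.pderiv j f) ⊗ₜ[ℂ] wedgeContract j i w := by
    simp only [interiorProduct, LinearMap.sum_apply, TensorProduct.map_tmul, map_sum,
      LinearMap.mulLeft_apply, deRham_tmul, ← Finset.sum_add_distrib]
    refine Finset.sum_congr rfl fun i _ => Finset.sum_congr rfl fun j _ => ?_
    rw [← wedgeContract_apply, MvPolynomial.pderiv_mul, TensorProduct.add_tmul]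
  have h2 : interiorProduct v (deRham n (f ⊗ₜ w)) = v f ⊗ₜ w -
      ∑ i, ∑ j, (v (MvPolynomial.X i) * MvPolynomial.pderiv j f) ⊗ₜ[ℂ] wedgeContract j i w := by
    rw [derivation_eq_sum_pderiv v f, TensorProduct.sum_tmul, ← Finset.sum_sub_distrib]
    simp only [interiorProduct, LinearMap.sum_apply, TensorProduct.map_tmul, map_sum,
      LinearMap.mulLeft_apply, deRham_tmul]
    rw [Finset.sum_comm]
    refine Finset.sum_congr rfl fun i _ => ?_
    simp only [contractLeft_dx_mul, TensorProduct.tmul_sub, Finset.sum_sub_distrib]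
    congr 1
    rw [Finset.sum_eq_single i]
    · rw [if_pos rfl]
    · intro j _ hj
      rw [if_neg hj, TensorProduct.tmul_zero]
    · intro hi
      exact absurd (Finset.mem_univ i) hi
  change deRham n (interiorProduct v (f ⊗ₜ w)) + interiorProduct v (deRham n (f ⊗ₜ w)) = _
  rw [h1, h2]
  abel

theorem lieDerivative_mul (v : W n) (a b : Forms n) :
    lieDerivative v (a * b) = lieDerivative v a * b + a * lieDerivative v b := by
  induction a using TensorProduct.induction_on with
  | zero => simp
  | add x y hx hy => simp only [add_mul, map_add, hx, hy]; abel
  | tmul f w =>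
    induction b using TensorProduct.induction_on with
    | zero => simp
    | add x y hx hy => simp only [mul_add, map_add, hx, hy]; abel
    | tmul g u =>
      have h : ∀ i j, (MvPolynomial.pderiv j (v (MvPolynomial.X i)) * (f * g)) ⊗ₜ[ℂ]
          wedgeContract j i (w * u) =
          (MvPolynomial.pderiv j (v (MvPolynomial.X i)) * f) ⊗ₜ[ℂ] wedgeContract j i w *
            g ⊗ₜ u + f ⊗ₜ w *
          (MvPolynomial.pderiv j (v (MvPolynomial.X i)) * g) ⊗ₜ[ℂ] wedgeContract j i u := by
        intro i j
        rw [wedgeContract_mul, TensorProduct.tmul_add, Algebra.TensorProduct.tmul_mul_tmul,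
          Algebra.TensorProduct.tmul_mul_tmul, mul_assoc, mul_left_comm f]
      rw [Algebra.TensorProduct.tmul_mul_tmul, lieDerivative_tmul, lieDerivative_tmul,
        lieDerivative_tmul]
      simp only [h, Finset.sum_add_distrib]
      rw [add_mul, mul_add, Algebra.TensorProduct.tmul_mul_tmul,
        Algebra.TensorProduct.tmul_mul_tmul, Derivation.leibniz, smul_eq_mul, smul_eq_mul,
        TensorProduct.add_tmul, mul_comm g]
      simp only [Finset.sum_mul, Finset.mul_sum]
      abel

theorem lieDerivative_deRham (v : W n) (a : Forms n) :
    lieDerivative v (deRham n a) = deRham n (lieDerivative v a) := by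
  change deRham n (interiorProduct v (deRham n a)) + interiorProduct v (deRham n (deRham n a)) =
    deRham n (deRham n (interiorProduct v a) + interiorProduct v (deRham n a))
  rw [deRham_deRham, map_zero, map_add, deRham_deRham, zero_add, add_zero]

theorem lieDerivative_mem_even (v : W n) {a : Forms n} (ha : a ∈ evenForms n) :
    lieDerivative v a ∈ evenForms n := by
  refine even_induction (p := fun a => lieDerivative v a ∈ evenForms n) (fun f w hw => ?_)
    (fun x y hx hy => ?_) a ha
  · rw [lieDerivative_tmul]
    exact add_mem (tmul_mem_even _ _ hw) (sum_mem fun i _ => sum_mem fun j _ =>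
      tmul_mem_even _ _ (wedgeContract_mem_even j i w hw))
  · rw [map_add]; exact add_mem hx hy

theorem lieDerivative_tmul_one (v : W n) (f : Poly n) :
    lieDerivative v (f ⊗ₜ 1) = v f ⊗ₜ 1 := by
  rw [lieDerivative_tmul, add_eq_left]
  refine Finset.sum_eq_zero fun i _ => Finset.sum_eq_zero fun j _ => ?_
  rw [wedgeContract_one, TensorProduct.tmul_zero]

/-- The Lie derivative along `v` as a derivation of `Ω_*^even`. -/
def lieDerOmega (v : W n) : Der (OmegaStar n) :=
  ⟨{ toFun := fun a => ⟨lieDerivative v a.form, lieDerivative_mem_even v a.form_mem⟩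
     map_add' := fun a b => OmegaStar.ext (map_add (lieDerivative v) a.form b.form)
     map_smul' := fun c a => OmegaStar.ext (map_smul (lieDerivative v) c a.form) }, by
    intro a b
    refine OmegaStar.ext ?_
    change lieDerivative v (a * b).form =
      (lieDerivative v a.form * b.form + (1 / 2 : ℂ) •
        (deRham n (lieDerivative v a.form) * deRham n b.form)) +
      (a.form * lieDerivative v b.form + (1 / 2 : ℂ) •
        (deRham n a.form * deRham n (lieDerivative v b.form)))
    rw [OmegaStar.form_mul, map_add, map_smul, lieDerivative_mul, lieDerivative_mul,
      lieDerivative_deRham, lieDerivative_deRham, smul_add]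
    abel⟩

theorem form_lieDerOmega (v : W n) (a : OmegaStar n) :
    ((lieDerOmega v).1 a).form = lieDerivative v a.form := rfl

theorem adjoin_x : Algebra.adjoin ℂ (Set.range (OmegaStar.x : Fin n → OmegaStar n)) = ⊤ := by
  have := congrArg (Subalgebra.map (omegaEquiv n : (An n ⧸ M (An n) 3) →ₐ[ℂ] OmegaStar n))
    (adjoin_ι_quotient (n := n))
  rw [AlgHom.map_adjoin, Algebra.map_top, ← Set.range_comp] at this
  have h : (omegaEquiv n : (An n ⧸ M (An n) 3) →ₐ[ℂ] OmegaStar n) ∘ (fun i : Fin n =>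
      (Ideal.Quotient.mk (M (An n) 3) (FreeAlgebra.ι ℂ i))) = OmegaStar.x :=
    funext fun i => toOmega_gen i
  rw [h] at this
  refine this.trans ?_
  rw [AlgHom.range_eq_top]
  exact (omegaEquiv n).surjective

/-- A function `f` as an element of `Ω_*^even`. -/
def OmegaStar.fn (f : Poly n) : OmegaStar n := ⟨f ⊗ₜ 1, tmul_mem_even _ _ (one_mem _)⟩

theorem OmegaStar.form_fn (f : Poly n) : (OmegaStar.fn f).form = f ⊗ₜ 1 := rfl

theorem OmegaStar.fn_add (f g : Poly n) : fn (f + g) = fn f + fn g :=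
  OmegaStar.ext (TensorProduct.add_tmul f g 1)

theorem OmegaStar.fn_sub (f g : Poly n) : fn (f - g) = fn f - fn g :=
  OmegaStar.ext (TensorProduct.sub_tmul f g 1)

theorem OmegaStar.fn_smul (c : ℂ) (f : Poly n) : fn (c • f) = c • fn f :=
  OmegaStar.ext (TensorProduct.smul_tmul' c f 1)

theorem OmegaStar.fn_injective : Function.Injective (fn : Poly n → OmegaStar n) := by
  intro f g h
  have h1 := congrArg (Algebra.TensorProduct.lift (AlgHom.id ℂ (Poly n))
    ((Algebra.ofId ℂ (Poly n)).comp (ExteriorAlgebra.algebraMapInv (R := ℂ) (M := Fin n → ℂ)))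
    (fun _ _ => Commute.all _ _)) (congrArg OmegaStar.form h)
  simpa [OmegaStar.form_fn] using h1

theorem lieDerOmega_fn (v : W n) (f : Poly n) :
    (lieDerOmega v).1 (OmegaStar.fn f) = OmegaStar.fn (v f) :=
  OmegaStar.ext (lieDerivative_tmul_one v f)

theorem lieDerOmega_x (v : W n) (i : Fin n) :
    (lieDerOmega v).1 (OmegaStar.x i) = OmegaStar.fn (v (MvPolynomial.X i)) :=
  lieDerOmega_fn v (MvPolynomial.X i)

theorem Der.ext_x {D E : Der (OmegaStar n)}
    (h : ∀ i, D.1 (OmegaStar.x i) = E.1 (OmegaStar.x i)) : D = E :=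
  Der.ext_of_adjoin adjoin_x (by rintro _ ⟨i, rfl⟩; exact h i)

variable (n)

/-- The Lie derivative `W_n → Der(Ω_*^even)`. -/
def lieDerHom : W n →ₗ⁅ℂ⁆ Der (OmegaStar n) where
  toFun := lieDerOmega
  map_add' v w := Der.ext_x fun i => by
    change _ = (lieDerOmega v).1 _ + (lieDerOmega w).1 _
    rw [lieDerOmega_x, lieDerOmega_x, lieDerOmega_x, Derivation.add_apply, OmegaStar.fn_add]
  map_smul' c v := Der.ext_x fun i => by
    change _ = c • (lieDerOmega v).1 _
    rw [lieDerOmega_x, lieDerOmega_x, Derivation.smul_apply, OmegaStar.fn_smul]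
  map_lie' {v w} := Der.ext_x fun i => by
    change _ = (lieDerOmega v).1 ((lieDerOmega w).1 _) - (lieDerOmega w).1 ((lieDerOmega v).1 _)
    rw [lieDerOmega_x, lieDerOmega_x, lieDerOmega_x, lieDerOmega_fn, lieDerOmega_fn,
      Derivation.commutator_apply, OmegaStar.fn_sub]

theorem lieDerHom_injective : Function.Injective (lieDerHom n) := by
  intro v w h
  refine MvPolynomial.derivation_ext fun i => OmegaStar.fn_injective ?_
  rw [← lieDerOmega_x, ← lieDerOmega_x]
  exact congrArg (fun D : Der (OmegaStar n) => D.1 (OmegaStar.x i)) h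

end Lie

/-! ### Gradings by the eigenvalues of an endomorphism -/

section Eigen

variable {V : Type*} [AddCommGroup V] [Module ℂ V]

/-- An invariant subspace which contains a sum of eigenvectors with distinct eigenvalues contains
each of them. -/
theorem mem_of_sum_eigenvectors_mem {T : Module.End ℂ V} {P : Submodule ℂ V}
    (hP : ∀ x ∈ P, T x ∈ P) (s : Finset ℕ) (x : ℕ → V) (hx : ∀ d ∈ s, T (x d) = (d : ℂ) • x d)
    (h : ∑ d ∈ s, x d ∈ P) : ∀ d ∈ s, x d ∈ P := by
  induction s using Finset.induction_on generalizing x with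
  | empty => simp
  | insert e s he ih =>
    have hs : ∀ d ∈ s, x d ∈ P := by
      -- applying `T - e` removes the eigenvector of eigenvalue `e`
      have h1 : ∑ d ∈ s, ((d : ℂ) - e) • x d ∈ P := by
        have h2 := P.sub_mem (hP _ h) (P.smul_mem (e : ℂ) h)
        rw [map_sum, Finset.smul_sum, ← Finset.sum_sub_distrib, Finset.sum_insert he,
          hx e (Finset.mem_insert_self _ _), sub_self, zero_add] at h2
        convert h2 using 2 with d hd
        rw [hx d (Finset.mem_insert_of_mem hd), sub_smul]
      intro d hd
      have h3 := ih (fun d => ((d : ℂ) - e) • x d) (fun d hd => by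
        rw [map_smul, hx d (Finset.mem_insert_of_mem hd), smul_comm]) h1 d hd
      refine (P.smul_mem_iff ?_).mp h3
      rw [sub_ne_zero]
      exact fun h => he (Nat.cast_injective h ▸ hd)
    intro d hd
    rcases Finset.mem_insert.mp hd with rfl | hd
    · rw [Finset.sum_insert he] at h
      exact (P.add_mem_iff_left (P.sum_mem hs)).mp h
    · exact hs d hd

theorem eq_zero_of_sum_eigenvectors {T : Module.End ℂ V} {c : ℂ} (s : Finset ℕ) (x : ℕ → V)
    (hx : ∀ d ∈ s, T (x d) = (d : ℂ) • x d) (h : T (∑ d ∈ s, x d) = c • ∑ d ∈ s, x d) :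
    ∀ d ∈ s, (d : ℂ) ≠ c → x d = 0 := by
  intro d hd hdc
  have h1 : ∑ d ∈ s, ((d : ℂ) - c) • x d ∈ (⊥ : Submodule ℂ V) := by
    rw [map_sum, Finset.smul_sum, ← sub_eq_zero, ← Finset.sum_sub_distrib] at h
    rw [Submodule.mem_bot, ← h]
    exact Finset.sum_congr rfl fun d hd => by rw [hx d hd, sub_smul]
  have h2 := mem_of_sum_eigenvectors_mem (T := T) (by simp) s (fun d => ((d : ℂ) - c) • x d)
    (fun d hd => by rw [map_smul, hx d hd, smul_comm]) h1 d hd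
  exact (smul_eq_zero.mp h2).resolve_left (sub_ne_zero.mpr hdc)

theorem isInternal_of_eigenvalues {ι : Type*} [DecidableEq ι] (T : Module.End ℂ V)
    (gr : ι → Submodule ℂ V) (c : ι → ℂ) (hc : Function.Injective c)
    (hT : ∀ d, ∀ x ∈ gr d, T x = c d • x) (hspan : ⨆ d, gr d = ⊤) : DirectSum.IsInternal gr := by
  refine DirectSum.isInternal_submodule_of_iSupIndep_of_iSup_eq_top ?_ hspan
  refine (T.eigenspaces_iSupIndep.comp hc).mono fun d x hx => ?_
  exact Module.End.mem_eigenspace_iff.mpr (hT d x hx)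

end Eigen

/-! ### The grading of `W_n` -/

section GradedW

variable (n : ℕ)

/-- The Euler vector field `∑ i, x_i ∂_i`. -/
def eulerW : W n := MvPolynomial.mkDerivation ℂ MvPolynomial.X

variable {n}

theorem eulerW_X (i : Fin n) : eulerW n (MvPolynomial.X i) = MvPolynomial.X i :=
  MvPolynomial.mkDerivation_X _ _ _

theorem coeff_eulerW (f : Poly n) (m : Fin n →₀ ℕ) :
    (eulerW n f).coeff m = (m.degree : ℂ) * f.coeff m := by
  induction f using MvPolynomial.induction_on' with
  | monomial u a =>
    rw [derivation_eq_sum_pderiv]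
    simp only [eulerW_X, MvPolynomial.X_mul_pderiv_monomial]
    rw [← Finset.sum_smul, MvPolynomial.coeff_smul, MvPolynomial.coeff_monomial]
    split_ifs with h
    · subst h
      rw [Finsupp.degree_eq_sum, nsmul_eq_mul]
    · simp
  | add p q hp hq => rw [map_add, MvPolynomial.coeff_add, MvPolynomial.coeff_add, hp, hq, mul_add]

theorem mem_grW_iff {k : ℤ} {v : W n} : v ∈ grW n k ↔ ⁅eulerW n, v⁆ = (k : ℂ) • v := by
  have h1 : v ∈ grW n k ↔ ∀ i m, ((v (MvPolynomial.X i)).coeff m ≠ 0 → (m.degree : ℤ) = k + 1) :=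
    forall_congr' fun i => forall_congr' fun m => by rw [MvPolynomial.mem_support_iff]
  have h2 : ⁅eulerW n, v⁆ = (k : ℂ) • v ↔ ∀ i m, (⁅eulerW n, v⁆ (MvPolynomial.X i)).coeff m =
      (((k : ℂ) • v) (MvPolynomial.X i)).coeff m :=
    ⟨fun h i m => by rw [h], fun h => MvPolynomial.derivation_ext fun i =>
      MvPolynomial.ext _ _ (h i)⟩
  rw [h1, h2]
  refine forall_congr' fun i => forall_congr' fun m => ?_
  rw [Derivation.commutator_apply, eulerW_X, MvPolynomial.coeff_sub, coeff_eulerW,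
    Derivation.smul_apply, MvPolynomial.coeff_smul, smul_eq_mul]
  constructor
  · intro h
    by_cases h0 : (v (MvPolynomial.X i)).coeff m = 0
    · rw [h0]; ring
    · have h3 : (m.degree : ℂ) = k + 1 := by exact_mod_cast congrArg (Int.cast : ℤ → ℂ) (h h0)
      rw [h3]; ring
  · intro h h0
    have h3 : (m.degree : ℂ) = k + 1 :=
      mul_right_cancel₀ h0 (by linear_combination h)
    exact_mod_cast h3

theorem lie_mem_grW {k l : ℤ} {v w : W n} (hv : v ∈ grW n k) (hw : w ∈ grW n l) :
    ⁅v, w⁆ ∈ grW n (k + l) := by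
  rw [mem_grW_iff] at *
  have jacobi : ⁅eulerW n, ⁅v, w⁆⁆ = ⁅⁅eulerW n, v⁆, w⁆ + ⁅v, ⁅eulerW n, w⁆⁆ :=
    Derivation.ext fun f => by
      simp only [Derivation.add_apply, Derivation.commutator_apply, map_sub]
      abel
  rw [jacobi, hv, hw, Int.cast_add]
  refine Derivation.ext fun f => ?_
  simp only [Derivation.add_apply, Derivation.smul_apply, Derivation.commutator_apply,
    Derivation.map_smul, add_smul, smul_sub]

theorem iSup_grW : ⨆ k, grW n k = ⊤ := by
  refine eq_top_iff.mpr fun v _ => ?_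
  have hv : v = ∑ i, v (MvPolynomial.X i) • MvPolynomial.pderiv i := by
    refine MvPolynomial.derivation_ext fun j => ?_
    rw [derivation_eq_sum_pderiv v, derivation_sum_apply]
    rfl
  rw [hv]
  refine Submodule.sum_mem _ fun i _ => ?_
  induction v (MvPolynomial.X i) using MvPolynomial.induction_on' with
  | add p q hp hq => rw [add_smul]; exact add_mem hp hq
  | monomial m a =>
    refine Submodule.mem_iSup_of_mem ((m.degree : ℤ) - 1) fun j u hu => ?_
    by_cases hij : j = i
    · subst hij
      rw [Derivation.smul_apply, MvPolynomial.pderiv_X_self, smul_eq_mul, mul_one] at hu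
      rw [Finset.mem_singleton.mp (MvPolynomial.support_monomial_subset hu)]
      ring
    · rw [Derivation.smul_apply, MvPolynomial.pderiv_X_of_ne hij, smul_zero] at hu
      simp at hu

theorem isInternal_grW : DirectSum.IsInternal (grW n) :=
  isInternal_of_eigenvalues (LieAlgebra.ad ℂ (W n) (eulerW n)) (grW n) (fun k => (k : ℂ))
    Int.cast_injective (fun _ _ hv => mem_grW_iff.mp hv) iSup_grW

end GradedW

/-! ### The grading of the free algebra -/

section GradedA

variable (n : ℕ)

/-- The derivation of `A_n` which multiplies words of length `d` by `d`. -/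
def eulerA : Der (An n) := freeDer (FreeAlgebra.ι ℂ)

variable {n}

theorem eulerA_ι (i : Fin n) : (eulerA n).1 (FreeAlgebra.ι ℂ i) = FreeAlgebra.ι ℂ i :=
  freeDer_ι _ i

theorem eulerA_of_mem_grA {d : ℕ} {a : An n} (ha : a ∈ grA n d) :
    (eulerA n).1 a = (d : ℂ) • a := by
  induction d generalizing a with
  | zero =>
    obtain ⟨r, rfl⟩ := Submodule.mem_one.mp ha
    rw [Der.map_algebraMap, Nat.cast_zero, zero_smul]
  | succ d ih =>
    have h1 : ∀ a ∈ Submodule.span ℂ (Set.range (FreeAlgebra.ι ℂ : Fin n → An n)),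
        (eulerA n).1 a = a := fun a ha =>
      LinearMap.eqOn_span (f := (eulerA n).1) (g := LinearMap.id)
        (by rintro _ ⟨i, rfl⟩; exact eulerA_ι i) ha
    rw [grA, pow_succ'] at ha
    refine Submodule.mul_induction_on ha (fun x hx y hy => ?_) (fun x y hx hy => ?_)
    · rw [Der.leibniz, h1 x hx, ih hy, mul_smul_comm, Nat.cast_succ, add_smul, one_smul, add_comm]
    · rw [map_add, hx, hy, smul_add]

theorem iSup_grA : ⨆ d, grA n d = ⊤ := by
  refine eq_top_iff.mpr fun a _ => ?_
  induction a using FreeAlgebra.induction with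
  | grade0 r => exact Submodule.mem_iSup_of_mem 0 (Submodule.mem_one.mpr ⟨r, rfl⟩)
  | grade1 i =>
    refine Submodule.mem_iSup_of_mem 1 ?_
    rw [grA, pow_one]
    exact Submodule.subset_span ⟨i, rfl⟩
  | add a b ha hb => exact add_mem (ha trivial) (hb trivial)
  | mul a b ha hb =>
    have h := Submodule.mul_mem_mul (ha trivial) (hb trivial)
    rw [Submodule.iSup_mul] at h
    suffices h1 : ⨆ d, grA n d * ⨆ e, grA n e ≤ ⨆ d, grA n d from h1 h
    refine iSup_le fun d => ?_
    rw [Submodule.mul_iSup]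
    refine iSup_le fun e => ?_
    rw [grA, grA, ← pow_add]
    exact le_iSup (grA n) (d + e)

theorem exists_sum_grA (a : An n) :
    ∃ (s : Finset ℕ) (x : ℕ → An n), (∀ d, x d ∈ grA n d) ∧ ∑ d ∈ s, x d = a := by
  have ha : a ∈ ⨆ d, grA n d := iSup_grA (n := n) ▸ Submodule.mem_top
  obtain ⟨f, hf, rfl⟩ := (Submodule.mem_iSup_iff_exists_finsupp _ _).mp ha
  exact ⟨f.support, f, hf, rfl⟩

theorem mem_grA_of_eulerA {e : ℕ} {a : An n} (ha : (eulerA n).1 a = (e : ℂ) • a) :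
    a ∈ grA n e := by
  obtain ⟨s, x, hx, rfl⟩ := exists_sum_grA a
  have h := eq_zero_of_sum_eigenvectors s x (fun d _ => eulerA_of_mem_grA (hx d)) ha
  refine Submodule.sum_mem _ fun d hd => ?_
  by_cases hde : d = e
  · exact hde ▸ hx d
  · rw [h d hd (fun h => hde (Nat.cast_injective h))]; exact zero_mem _

theorem eq_zero_of_eulerA {c : ℂ} (hc : ∀ d : ℕ, (d : ℂ) ≠ c) {a : An n}
    (ha : (eulerA n).1 a = c • a) : a = 0 := by
  obtain ⟨s, x, hx, rfl⟩ := exists_sum_grA a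
  have h := eq_zero_of_sum_eigenvectors s x (fun d _ => eulerA_of_mem_grA (hx d)) ha
  exact Finset.sum_eq_zero fun d hd => h d hd (hc d)

/-- A subspace stable under the Euler derivation is homogeneous. -/
theorem iSup_grA_submoduleOf (P : Submodule ℂ (An n)) (hP : ∀ x ∈ P, (eulerA n).1 x ∈ P) :
    ⨆ d, (grA n d).submoduleOf P = ⊤ := by
  refine eq_top_iff.mpr fun a _ => ?_
  obtain ⟨s, x, hx, ha⟩ := exists_sum_grA a.1
  have h := mem_of_sum_eigenvectors_mem hP s x (fun d _ => eulerA_of_mem_grA (hx d)) (ha ▸ a.2)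
  have h1 : a = ∑ d ∈ s.attach, ⟨x d.1, h d.1 d.2⟩ := by
    refine Subtype.ext ?_
    rw [← ha, AddSubmonoidClass.coe_finsetSum, Finset.sum_attach s x]
  rw [h1]
  exact Submodule.sum_mem _ fun d _ => Submodule.mem_iSup_of_mem d.1 (hx d.1)

/-! ### Homogeneous lifts of vector fields -/

/-- A homogeneous function is the image of a homogeneous element of `A_n` of the same degree. -/
theorem exists_homogeneous_preimage {c : ℂ} {f : Poly n} (hf : eulerW n f = c • f) :
    ∃ a : An n, (eulerA n).1 a = c • a ∧
      omegaEquiv n (Ideal.Quotient.mk _ a) = OmegaStar.fn f := by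
  have hlift : IsLift (omegaEquiv n) (lieDerHom n) (eulerW n) (eulerA n) :=
    isLift_freeDer _ _ _ _ fun i => by
      change toOmega n (genQuot n i) = (lieDerOmega (eulerW n)).1 (toOmega n (genQuot n i))
      rw [toOmega_gen, lieDerOmega_x, eulerW_X]
      rfl
  let F : An n →ₗ[ℂ] OmegaStar n :=
    (toOmega n).toLinearMap ∘ₗ (Ideal.Quotient.mkₐ ℂ (M (An n) 3)).toLinearMap
  have hF : ∀ a, (lieDerOmega (eulerW n)).1 (F a) = F ((eulerA n).1 a) := fun a =>
    (hlift (Ideal.Quotient.mk _ a)).symm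
  obtain ⟨q, hq⟩ := (toOmega_bijective n).2 (OmegaStar.fn f)
  obtain ⟨a, rfl⟩ := Ideal.Quotient.mk_surjective q
  obtain ⟨s, x, hx, rfl⟩ := exists_sum_grA a
  replace hq : F (∑ d ∈ s, x d) = OmegaStar.fn f := hq
  have hsum : ∑ d ∈ s, F (x d) = OmegaStar.fn f := by rw [← hq, map_sum]
  have h := eq_zero_of_sum_eigenvectors (T := (lieDerOmega (eulerW n)).1) (c := c) s
    (fun d => F (x d)) (fun d _ => by rw [hF, eulerA_of_mem_grA (hx d), map_smul])
    (by rw [hsum, lieDerOmega_fn, hf, OmegaStar.fn_smul])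
  classical
  refine ⟨∑ d ∈ s.filter (fun d : ℕ => (d : ℂ) = c), x d, ?_, ?_⟩
  · rw [map_sum, Finset.smul_sum]
    exact Finset.sum_congr rfl fun d hd => by
      rw [eulerA_of_mem_grA (hx d), (Finset.mem_filter.mp hd).2]
  · change F (∑ d ∈ s.filter (fun d : ℕ => (d : ℂ) = c), x d) = _
    rw [map_sum, ← hsum, Finset.sum_filter]
    refine Finset.sum_congr rfl fun d hd => ?_
    split_ifs with hdc
    · rfl
    · exact (h d hd hdc).symm

/-- A vector field of degree `k` lifts to a derivation of `A_n` of degree `k`. -/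
theorem exists_homogeneous_lift {k : ℤ} {v : W n} (hv : v ∈ grW n k) :
    ∃ D : Der (An n), IsLift (omegaEquiv n) (lieDerHom n) v D ∧
      ⁅eulerA n, D⁆ = (k : ℂ) • D := by
  have hf : ∀ i, eulerW n (v (MvPolynomial.X i)) = ((k : ℂ) + 1) • v (MvPolynomial.X i) := by
    intro i
    have h := congrArg (fun w : W n => w (MvPolynomial.X i)) (mem_grW_iff.mp hv)
    simp only [Derivation.commutator_apply, eulerW_X, Derivation.smul_apply] at h
    rw [add_smul, one_smul, ← h, sub_add_cancel]
  choose d hd hφ using fun i => exists_homogeneous_preimage (hf i)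
  refine ⟨freeDer d, isLift_freeDer _ _ _ _ fun i => ?_, ?_⟩
  · rw [hφ]
    change _ = (lieDerOmega v).1 (toOmega n (genQuot n i))
    rw [toOmega_gen, lieDerOmega_x]
  · refine Der.ext_of_adjoin (FreeAlgebra.adjoin_range_ι ℂ (Fin n)) ?_
    rintro _ ⟨i, rfl⟩
    change (eulerA n).1 ((freeDer d).1 _) - (freeDer d).1 ((eulerA n).1 _) =
      (k : ℂ) • (freeDer d).1 _
    rw [eulerA_ι, freeDer_ι, hd, add_smul, one_smul, add_sub_cancel_right]

theorem eulerA_map_of_lie_eq {k : ℤ} {D : Der (An n)} (hD : ⁅eulerA n, D⁆ = (k : ℂ) • D)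
    {d : ℕ} {a : An n} (ha : a ∈ grA n d) :
    (eulerA n).1 (D.1 a) = ((d + k : ℤ) : ℂ) • D.1 a := by
  have h : (eulerA n).1 (D.1 a) - D.1 ((eulerA n).1 a) = (k : ℂ) • D.1 a :=
    congrArg (fun E : Der (An n) => E.1 a) hD
  rw [eulerA_of_mem_grA ha, map_smul, sub_eq_iff_eq_add, ← add_smul] at h
  rw [h]
  push_cast
  rw [add_comm]

/-- A representation of `W_n` induced by a representation of `Der(A_n)` is graded if the latter
respects the degrees. -/
theorem isGradedModule_of_isInduced {V : Type*} [AddCommGroup V] [Module ℂ V]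
    {act : Der (An n) →ₗ⁅ℂ⁆ Module.End ℂ V} {ρ : W n →ₗ⁅ℂ⁆ Module.End ℂ V}
    (hρ : IsInduced (omegaEquiv n) (lieDerHom n) act ρ) (gr : ℕ → Submodule ℂ V)
    (hspan : ⨆ d, gr d = ⊤)
    (hmap : ∀ (D : Der (An n)) (d e : ℕ), (∀ a ∈ grA n d, D.1 a ∈ grA n e) →
      ∀ x ∈ gr d, act D x ∈ gr e)
    (hsmul : ∀ (D : Der (An n)) (d : ℕ) (c : ℂ), (∀ a ∈ grA n d, D.1 a = c • a) →
      ∀ x ∈ gr d, act D x = c • x) : IsGradedModule ρ gr where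
  isInternal := isInternal_of_eigenvalues (act (eulerA n)) gr (fun d => (d : ℂ))
    Nat.cast_injective (fun d => hsmul _ d d fun _ ha => eulerA_of_mem_grA ha) hspan
  map_mem k d e he v hv x hx := by
    obtain ⟨D, hD, hk⟩ := exists_homogeneous_lift hv
    rw [hρ v D hD]
    refine hmap D d e (fun a ha => mem_grA_of_eulerA ?_) x hx
    rw [eulerA_map_of_lie_eq hk ha, ← he, Int.cast_natCast]
  map_eq_zero k d hd v hv x hx := by
    obtain ⟨D, hD, hk⟩ := exists_homogeneous_lift hv
    rw [hρ v D hD, hsmul D d 0 (fun a ha => ?_) x hx, zero_smul]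
    rw [zero_smul]
    refine eq_zero_of_eulerA (fun e he => ?_) (eulerA_map_of_lie_eq hk ha)
    have h : (e : ℤ) = d + k := by exact_mod_cast he
    omega

theorem iSup_grB (i : ℕ) : ⨆ d, grB n i d = ⊤ := by
  have h := iSup_grA_submoduleOf (L (An n) i) (Der.map_L (eulerA n) i)
  simp only [grB]
  rw [← Submodule.map_iSup, h, Submodule.map_top, Submodule.range_mkQ]

theorem actB_mem_grB (i : ℕ) (D : Der (An n)) (d e : ℕ) (hD : ∀ a ∈ grA n d, D.1 a ∈ grA n e) :
    ∀ x ∈ grB n i d, actB (An n) i D x ∈ grB n i e := by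
  rintro _ ⟨x, hx, rfl⟩
  exact ⟨actL (An n) i D x, hD x.1 hx, rfl⟩

theorem actB_eq_smul (i : ℕ) (D : Der (An n)) (d : ℕ) (c : ℂ)
    (hD : ∀ a ∈ grA n d, D.1 a = c • a) : ∀ x ∈ grB n i d, actB (An n) i D x = c • x := by
  rintro _ ⟨x, hx, rfl⟩
  exact congrArg (Submodule.mkQ _) (Subtype.ext (hD x.1 hx) : actL (An n) i D x = c • x)

theorem isGradedModule_grB (i : ℕ) {ρ : W n →ₗ⁅ℂ⁆ Module.End ℂ (B (An n) i)}
    (hρ : IsInduced (omegaEquiv n) (lieDerHom n) (actB (An n) i) ρ) :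
    IsGradedModule ρ (grB n i) :=
  isGradedModule_of_isInduced hρ _ (iSup_grB i) (actB_mem_grB i) (actB_eq_smul i)

theorem isGradedModule_grN (i : ℕ) {ρ : W n →ₗ⁅ℂ⁆ Module.End ℂ (N (An n) i)}
    (hρ : IsInduced (omegaEquiv n) (lieDerHom n) (actN (An n) i) ρ) :
    IsGradedModule ρ (grN n i) := by
  refine isGradedModule_of_isInduced hρ _ ?_ ?_ ?_
  · have h := iSup_grA_submoduleOf (Mc (An n) i) (Der.map_M (eulerA n) i)
    simp only [grN]
    rw [← Submodule.map_iSup, h, Submodule.map_top, Submodule.range_mkQ]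
  · rintro D d e hD _ ⟨x, hx, rfl⟩
    exact ⟨actM (An n) i D x, hD x.1 hx, rfl⟩
  · rintro D d c hD _ ⟨x, hx, rfl⟩
    exact congrArg (Submodule.mkQ _) (Subtype.ext (hD x.1 hx) : actM (An n) i D x = c • x)

theorem isGradedModule_grBbar1 {ρ : W n →ₗ⁅ℂ⁆ Module.End ℂ (Bbar1 (An n))}
    (hρ : IsInduced (omegaEquiv n) (lieDerHom n) (actBbar1 (An n)) ρ) :
    IsGradedModule ρ (grBbar1 n) := by
  refine isGradedModule_of_isInduced hρ _ ?_ ?_ ?_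
  · simp only [grBbar1]
    rw [← Submodule.map_iSup, iSup_grB, Submodule.map_top, Submodule.range_mkQ]
  · rintro D d e hD _ ⟨x, hx, rfl⟩
    exact ⟨actB (An n) 1 D x, actB_mem_grB 1 D d e hD x hx, rfl⟩
  · rintro D d c hD _ ⟨x, hx, rfl⟩
    exact congrArg (Submodule.mkQ _) (actB_eq_smul 1 D d c hD x hx)

end GradedA

end LCS

end

theorem mainTheorem6 (n : ℕ) :
    -- derivations with image in `M_3` act trivially, for every associative `ℂ`-algebra
    (∀ (A : Type*) [Ring A] [Algebra ℂ A] (D : LCS.Der A),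
      (∀ a : A, (D : Module.End ℂ A) a ∈ LCS.M A 3) →
        LCS.actBbar1 A D = 0 ∧ (∀ i, 2 ≤ i → LCS.actB A i D = 0) ∧
          (∀ i, 1 ≤ i → LCS.actN A i D = 0)) ∧
    -- `ψ : Der(A_n) → Der(A_n / M_3)` is surjective
    Function.Surjective (LCS.psi (LCS.An n)) ∧
    -- `W_n` is a graded Lie algebra
    DirectSum.IsInternal (LCS.grW n) ∧
    (∀ (k l : ℤ), ∀ v ∈ LCS.grW n k, ∀ w ∈ LCS.grW n l, ⁅v, w⁆ ∈ LCS.grW n (k + l)) ∧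
    -- the isomorphism `φ : A_n / M_3 ≅ Ω_*^even` and the inclusion `W_n ⊆ Der(Ω_*^even)`
    ∃ (φ : (LCS.An n ⧸ LCS.M (LCS.An n) 3) ≃ₐ[ℂ] LCS.OmegaStar n)
      (lam : LCS.W n →ₗ⁅ℂ⁆ LCS.Der (LCS.OmegaStar n)),
      (∀ i : Fin n, φ (Ideal.Quotient.mk _ (FreeAlgebra.ι ℂ i)) = LCS.OmegaStar.x i) ∧
      Function.Injective lam ∧
      (∀ (v : LCS.W n) (a : LCS.OmegaStar n),
        ((lam v : Module.End ℂ (LCS.OmegaStar n)) a).form = LCS.lieDerivative v a.form) ∧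
      -- the induced structures of graded `W_n`-modules
      (∃ ρ : LCS.W n →ₗ⁅ℂ⁆ Module.End ℂ (LCS.Bbar1 (LCS.An n)),
        LCS.IsInduced φ lam (LCS.actBbar1 (LCS.An n)) ρ ∧
        (∀ ρ', LCS.IsInduced φ lam (LCS.actBbar1 (LCS.An n)) ρ' → ρ' = ρ) ∧
        LCS.IsGradedModule ρ (LCS.grBbar1 n)) ∧
      (∀ i, 2 ≤ i → ∃ ρ : LCS.W n →ₗ⁅ℂ⁆ Module.End ℂ (LCS.B (LCS.An n) i),
        LCS.IsInduced φ lam (LCS.actB (LCS.An n) i) ρ ∧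
        (∀ ρ', LCS.IsInduced φ lam (LCS.actB (LCS.An n) i) ρ' → ρ' = ρ) ∧
        LCS.IsGradedModule ρ (LCS.grB n i)) ∧
      (∀ i, 1 ≤ i → ∃ ρ : LCS.W n →ₗ⁅ℂ⁆ Module.End ℂ (LCS.N (LCS.An n) i),
        LCS.IsInduced φ lam (LCS.actN (LCS.An n) i) ρ ∧
        (∀ ρ', LCS.IsInduced φ lam (LCS.actN (LCS.An n) i) ρ' → ρ' = ρ) ∧
        LCS.IsGradedModule ρ (LCS.grN n i)) := by
  refine ⟨fun A _ _ D hD => ⟨LCS.actBbar1_eq_zero D hD, fun i => LCS.actB_eq_zero D hD,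
    fun i => LCS.actN_eq_zero D hD⟩, LCS.psi_surjective, LCS.isInternal_grW,
    fun k l v hv w hw => LCS.lie_mem_grW hv hw, LCS.omegaEquiv n, LCS.lieDerHom n,
    LCS.toOmega_gen, LCS.lieDerHom_injective n, fun v a => LCS.form_lieDerOmega v a, ?_,
    fun i hi => ?_, fun i hi => ?_⟩
  · obtain ⟨ρ, hρ, huniq⟩ := LCS.existsUnique_isInduced (LCS.omegaEquiv n) (LCS.lieDerHom n)
      (LCS.actBbar1 (LCS.An n)) LCS.actBbar1_eq_zero
    exact ⟨ρ, hρ, huniq, LCS.isGradedModule_grBbar1 hρ⟩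
  · obtain ⟨ρ, hρ, huniq⟩ := LCS.existsUnique_isInduced (LCS.omegaEquiv n) (LCS.lieDerHom n)
      (LCS.actB (LCS.An n) i) fun D hD => LCS.actB_eq_zero D hD hi
    exact ⟨ρ, hρ, huniq, LCS.isGradedModule_grB i hρ⟩
  · obtain ⟨ρ, hρ, huniq⟩ := LCS.existsUnique_isInduced (LCS.omegaEquiv n) (LCS.lieDerHom n)
      (LCS.actN (LCS.An n) i) fun D hD => LCS.actN_eq_zero D hD hi
    exact ⟨ρ, hρ, huniq, LCS.isGradedModule_grN i hρ⟩
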